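/- Let $d\ge 1$, $q\ge 1$ and $s\ge 0$ be integers, let $p$ be real, and assume $p>2$, $q<p<2q$ and $s>\frac{d(2q-p)}{2pq}$. Let $\Omega=[0,1]^d$ and let $W^{s,p}(\Omega)$ be the Sobolev space of $f\in L^p(\Omega)$ whose weak derivatives of order at most $s$ lie in $L^p(\Omega)$, with norm $\|f\|_{W^{s,p}}=\max_{|\alpha|\le s}\|D^\alpha f\|_{L^p(\Omega)}$. Let $x_1,x_2,\dots$ be independent and uniformly distributed on $\Omega$. For every $n\ge 1$ let $K_n:\Omega^n\times\mathbb R^n\to W^{s,p}(\Omega)$ be a (measurable) function estimator. Say that $(K_n)$ has the *oracle rates* on a set $F\subset W^{s,p}(\Omega)$ if for every real $r\ge 1$ with $\frac1r>\frac{d-sp}{pd}$ there is a constant $C_r$ such that for all $f\in F$ and $n\ge 1$ $$\Big(\mathbb E\,\big\|K_n(\{x_i\}_{i=1}^n,\{f(x_i)\}_{i=1}^n)-f\big\|_{L^r(\Omega)}^r\Big)^{1/r}\le C_r\,n^{-\frac sd+\max\{\frac1p-\frac1r,\,0\}}.$$ For even $n\ge 2$ and data $y_i=f(x_i)$, put $\hat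 f=K_{n/2}(\{x_i\}_{i=1}^{n/2},\{y_i\}_{i=1}^{n/2})$ and define the regression-adjusted control variate estimator $$\hat H^q_C=\int_\Omega \hat f(x)^q\,dx+\frac2n\sum_{i=n/2+1}^n\big(y_i^q-\hat f(x_i)^q\big),\qquad I_f^q=\int_\Omega f(x)^q\,dx.$$ (1) For every $f\in W^{s,p}(\Omega)$ such that $(K_n)$ has the oracle rates on $\{f\}$ (constants may depend on $f$, but not on $n$), there is a constant $C$ such that for all even $n\ge 2$ the expectation below is finite and $$\mathbb E\,\big|\hat H^q_C-I_f^q\big|\le C\,n^{\max\{-q(\frac sd-\frac1p)-1,\;-\frac sd-\frac12\}}.$$ (2) If $(K_n)$ has the oracle rates on a ball $\{f:\|f\|_{W^{s,p}}\le R\}$ (constants uniform over the ball), then the bound in (1) holds with one constant $C$ for all $f$ in that ball and all even $n\ge 2$. -/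

import Mathlib

open MeasureTheory
open scoped ENNReal ContDiff

noncomputable section

namespace ControlVariate

/-- The unit cube `Ω = [0,1]^d`. -/
def cube (d : ℕ) : Set (Fin d → ℝ) := Set.Icc 0 1

/-- The open unit cube `(0,1)^d`, the interior of `Ω`. -/
def openCube (d : ℕ) : Set (Fin d → ℝ) := Set.univ.pi fun _ => Set.Ioo 0 1

/-- The uniform distribution on `Ω`, that is, Lebesgue measure on `Ω` (which has total mass one). -/
def unif (d : ℕ) : Measure (Fin d → ℝ) := volume.restrict (cube d)

/-- The joint law of `n` independent uniformly distributed points of `Ω`. -/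
def sampleLaw (d n : ℕ) : Measure (Fin n → Fin d → ℝ) := Measure.pi fun _ => unif d

/-- The classical partial derivative `∂_{i 0} ⋯ ∂_{i (k-1)} φ` of order `k`. As `i` runs through all
finite sequences of coordinates, these are (for smooth `φ`) all derivatives `D^α φ`, where the
multi-index `α` counts how often each coordinate occurs in `i`, so that `|α| = k`. -/
def partialDeriv {d k : ℕ} (i : Fin k → Fin d) (φ : (Fin d → ℝ) → ℝ) (x : Fin d → ℝ) : ℝ :=
  iteratedFDeriv ℝ k φ x fun j => Pi.single (i j) 1

/-- Test functions on the open cube: smooth, with compact support inside it. -/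
def IsTestFunction {d : ℕ} (φ : (Fin d → ℝ) → ℝ) : Prop :=
  ContDiff ℝ ∞ φ ∧ HasCompactSupport φ ∧ tsupport φ ⊆ openCube d

/-- `g` is the weak derivative of `f` on the cube for the differentiation
`∂_{i 0} ⋯ ∂_{i (k-1)}`. Used for `f` and `g` in `L^p(Ω)`, `p ≥ 1`, only. -/
def IsWeakDeriv {d k : ℕ} (i : Fin k → Fin d) (f g : (Fin d → ℝ) → ℝ) : Prop :=
  ∀ φ : (Fin d → ℝ) → ℝ, IsTestFunction φ →
    ∫ x in cube d, f x * partialDeriv i φ x = (-1) ^ k * ∫ x in cube d, g x * φ x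

/-- The Sobolev space `W^{s,p}(Ω)` (as a set of representatives): `f ∈ L^p(Ω)`, and all weak
derivatives of order at most `s` exist and lie in `L^p(Ω)`. -/
def sobolev (d s : ℕ) (p : ℝ) : Set ((Fin d → ℝ) → ℝ) :=
  {f | MemLp f (ENNReal.ofReal p) (unif d) ∧
    ∀ k ≤ s, ∀ i : Fin k → Fin d, ∃ g : (Fin d → ℝ) → ℝ,
      MemLp g (ENNReal.ofReal p) (unif d) ∧ IsWeakDeriv i f g}

/-- The ball of radius `R` of `W^{s,p}(Ω)` for the norm `max_{|α| ≤ s} ‖D^α f‖_{L^p(Ω)}`. -/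
def sobolevBall (d s : ℕ) (p R : ℝ) : Set ((Fin d → ℝ) → ℝ) :=
  {f | MemLp f (ENNReal.ofReal p) (unif d) ∧
    ∀ k ≤ s, ∀ i : Fin k → Fin d, ∃ g : (Fin d → ℝ) → ℝ,
      MemLp g (ENNReal.ofReal p) (unif d) ∧ IsWeakDeriv i f g ∧
        eLpNorm g (ENNReal.ofReal p) (unif d) ≤ ENNReal.ofReal R}

/-- A sequence of function estimators: `K n x y` is the function estimated from the `n` points `x`
and the `n` observed values `y`. -/
abbrev Oracle (d : ℕ) : Type :=
  (n : ℕ) → (Fin n → Fin d → ℝ) → (Fin n → ℝ) → (Fin d → ℝ) → ℝ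

/-- `K n` is a map `Ω^n × ℝ^n → W^{s,p}(Ω)`, and for data from `f ∈ W^{s,p}(Ω)` the value of the
estimated function at a point is measurable, up to null sets, in the sample and the point. -/
structure IsFunctionEstimator (d s : ℕ) (p : ℝ) (K : Oracle d) : Prop where
  mem_sobolev : ∀ n, 0 < n → ∀ x : Fin n → Fin d → ℝ, (∀ i, x i ∈ cube d) →
    ∀ y : Fin n → ℝ, K n x y ∈ sobolev d s p
  aemeasurable : ∀ n, 0 < n → ∀ f ∈ sobolev d s p,
    AEMeasurable (fun z : (Fin n → Fin d → ℝ) × (Fin d → ℝ) => K n z.1 (f ∘ z.1) z.2)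
      ((sampleLaw d n).prod (unif d))

/-- The rates required of the oracle, with constants `C` that are uniform over the class `F`:
for every finite `r` with `1/r ∈ ((d-sp)/(pd), 1]`,
`(E ‖K_n(x, f(x)) - f‖_{L^r}^r)^{1/r} ≤ C n^{-s/d + (1/p - 1/r)_+}`. -/
def HasOracleRate (d s : ℕ) (p : ℝ) (K : Oracle d) (F : Set ((Fin d → ℝ) → ℝ)) : Prop :=
  ∀ r : ℝ, 1 ≤ r → (d - s * p) / (p * d) < 1 / r →
    ∃ C : ℝ, ∀ f ∈ F, ∀ n : ℕ, 0 < n →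
      (∫⁻ x, eLpNorm (fun z => K n x (f ∘ x) z - f z) (ENNReal.ofReal r) (unif d) ^ r
          ∂(sampleLaw d n)) ^ (1 / r)
        ≤ ENNReal.ofReal (C * (n : ℝ) ^ (-(s : ℝ) / d + max (1 / p - 1 / r) 0))

/-- The `q`-th moment `I_f^q = ∫_Ω f^q`. -/
def moment {d : ℕ} (q : ℕ) (f : (Fin d → ℝ) → ℝ) : ℝ := ∫ z in cube d, f z ^ q

/-- The regression-adjusted control variate estimator from an even number `n = m + m` of data
points: the first half gives the control variate `g = K m`, the second half gives a Monte Carlo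
estimate of `∫_Ω (f^q - g^q)`. -/
def estimator {d : ℕ} (K : Oracle d) (q m : ℕ) (x : Fin (m + m) → Fin d → ℝ)
    (y : Fin (m + m) → ℝ) : ℝ :=
  let g : (Fin d → ℝ) → ℝ :=
    K m (fun i => x (Fin.castAdd m i)) (fun i => y (Fin.castAdd m i))
  (∫ z in cube d, g z ^ q) +
    2 / ((m + m : ℕ) : ℝ) *
      ∑ i : Fin m, (y (Fin.natAdd m i) ^ q - g (x (Fin.natAdd m i)) ^ q)

/-- `C` bounds the expected absolute error for `f` at the claimed rate, for every even sample size
`n = m + m ≥ 2`; in particular that expectation is finite. -/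
def ErrorBound (d s q : ℕ) (p : ℝ) (K : Oracle d) (f : (Fin d → ℝ) → ℝ) (C : ℝ) : Prop :=
  ∀ m : ℕ, 0 < m →
    Integrable (fun x => estimator K q m x (f ∘ x) - moment q f) (sampleLaw d (m + m)) ∧
    ∫ x, |estimator K q m x (f ∘ x) - moment q f| ∂(sampleLaw d (m + m))
      ≤ C * ((m + m : ℕ) : ℝ) ^
          max (-(q : ℝ) * ((s : ℝ) / d - 1 / p) - 1) (-(s : ℝ) / d - 1 / 2)

end ControlVariate

end

/-! Let g be the oracle's output on the first half of the data, and n = 2m. Given that half, the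
error of the estimator is exactly the error of an m-point Monte Carlo average of f^q - g^q, so its
conditional mean absolute value is at most m^(-1/2) ‖f^q - g^q‖₂.

Pointwise, |f^q - g^q| is at most a constant times |g - f| |f|^(q-1) + |g - f|^q. Hölder with 1/a +
1/b = 1/2 bounds the L² norm by ‖g - f‖_a ‖f‖_{b(q-1)}^(q-1) + ‖g - f‖_{2q}^q. The oracle rates at r
= a and r = 2q handle the differences, and the Sobolev embedding handles ‖f‖_{b(q-1)}. The term with
2q gives the exponent -q(s/d - 1/p) - 1; `exists_holder_exponents` picks a and b so that the other
term gives precisely the claimed maximum. When s/d < 1/p this may put b(q-1) at the critical Sobolev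
exponent, so the embedding is needed with its endpoint.

The embedding is proved directly on cubes, without extension operators. The Gagliardo-Nirenberg
argument for C¹ functions has constants uniform over cubes of side between 1/2 and 1. A function
with weak derivatives is mollified on slightly smaller cubes, where mollification commutes with
differentiation, and Fatou's lemma recovers the full cube (`exists_eLpNorm_le_of_isWeakDeriv`).
Induction on the order of differentiation finishes it (`exists_eLpNorm_le_of_mem_sobolevBall`). -/

/-! ### The Sobolev inequality for C¹ functions on cubes -/

/-- The fundamental theorem of calculus compares v x with v t for every t; averaging over t costs
the inverse length, at most 2. Since v need not vanish at the ends, the zeroth-order term stays. -/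
theorem enorm_le_lintegral_Icc_add_deriv {v : ℝ → ℝ} (hv : ContDiff ℝ 1 v) {a b : ℝ}
    (hab : 1 / 2 ≤ b - a) {x : ℝ} (hx : x ∈ Set.Icc a b) :
    ‖v x‖ₑ ≤ ∫⁻ t in Set.Icc a b, (2 * ‖v t‖ₑ + ‖deriv v t‖ₑ) := by
  have hvc : Continuous v := hv.continuous
  have hdc : Continuous (deriv v) := hv.continuous_deriv le_rfl
  set D := ∫⁻ t in Set.Icc a b, ‖deriv v t‖ₑ with hD
  set V : ℝ≥0∞ := volume (Set.Icc a b) with hV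
  have hVr : V = ENNReal.ofReal (b - a) := by rw [hV, Real.volume_Icc]
  have hV0 : V ≠ 0 := by rw [hVr]; simp; linarith
  have hVt : V ≠ ⊤ := by rw [hVr]; simp
  have hVi : V⁻¹ ≤ 2 := by
    rw [ENNReal.inv_le_iff_inv_le, hVr]
    have : (2 : ℝ≥0∞)⁻¹ = ENNReal.ofReal (1 / 2) := by
      rw [one_div, ENNReal.ofReal_inv_of_pos two_pos]; simp
    rw [this]
    exact ENNReal.ofReal_le_ofReal hab
  have key : ∀ t ∈ Set.Icc a b, ‖v x‖ₑ ≤ ‖v t‖ₑ + D := by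
    intro t ht
    have h1 : v x - v t = ∫ s in t..x, deriv v s :=
      (intervalIntegral.integral_deriv_eq_sub (fun s _ => (hv.differentiable one_ne_zero) s)
        (hdc.intervalIntegrable _ _)).symm
    have h2 : ‖v x - v t‖ₑ ≤ D := by
      rw [h1, ← enorm_norm, intervalIntegral.norm_integral_eq_norm_integral_uIoc, enorm_norm]
      refine (enorm_integral_le_lintegral_enorm _).trans ?_
      refine lintegral_mono_set ?_
      exact Set.uIoc_subset_uIcc.trans (Set.uIcc_subset_Icc ht hx)
    calc ‖v x‖ₑ = ‖v t + (v x - v t)‖ₑ := by congr 1; ring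
      _ ≤ ‖v t‖ₑ + ‖v x - v t‖ₑ := enorm_add_le _ _
      _ ≤ _ := by gcongr
  have h3 : ‖v x‖ₑ * V ≤ (∫⁻ t in Set.Icc a b, ‖v t‖ₑ) + D * V := by
    calc ‖v x‖ₑ * V = ∫⁻ t in Set.Icc a b, ‖v x‖ₑ := by simp [hV]
      _ ≤ ∫⁻ t in Set.Icc a b, (‖v t‖ₑ + D) :=
        setLIntegral_mono (by fun_prop) key
      _ = _ := by rw [lintegral_add_right _ measurable_const]; simp [hV]
  calc ‖v x‖ₑ = ‖v x‖ₑ * V * V⁻¹ := by rw [mul_assoc, ENNReal.mul_inv_cancel hV0 hVt, mul_one]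
    _ ≤ ((∫⁻ t in Set.Icc a b, ‖v t‖ₑ) + D * V) * V⁻¹ := by gcongr
    _ = (∫⁻ t in Set.Icc a b, ‖v t‖ₑ) * V⁻¹ + D := by
      rw [add_mul, mul_assoc, ENNReal.mul_inv_cancel hV0 hVt, mul_one]
    _ ≤ (∫⁻ t in Set.Icc a b, ‖v t‖ₑ) * 2 + D := by gcongr
    _ = _ := by
      rw [lintegral_add_left (by fun_prop), lintegral_const_mul _ (by fun_prop), mul_comm]

namespace ControlVariate

/-- Lebesgue measure on the cube `[a,b]^d`, as a product measure. -/
noncomputable def boxMeasure (d : ℕ) (a b : ℝ) : Measure (Fin d → ℝ) :=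
  Measure.pi fun _ => volume.restrict (Set.Icc a b)

theorem boxMeasure_eq_restrict (d : ℕ) (a b : ℝ) :
    boxMeasure d a b = volume.restrict (Set.univ.pi fun _ => Set.Icc a b) := by
  rw [boxMeasure, volume_pi, Measure.restrict_pi_pi]

theorem ae_mem_boxMeasure (d : ℕ) (a b : ℝ) :
    ∀ᵐ x ∂boxMeasure d a b, ∀ i, x i ∈ Set.Icc a b := by
  rw [boxMeasure_eq_restrict]
  filter_upwards [ae_restrict_mem (MeasurableSet.univ_pi fun _ => measurableSet_Icc)] with x hx i
  exact hx i (Set.mem_univ i)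

instance (d : ℕ) (a b : ℝ) : IsFiniteMeasure (boxMeasure d a b) := by
  rw [boxMeasure]; infer_instance

theorem boxMeasure_univ_le_one (d : ℕ) {a b : ℝ} (h : b - a ≤ 1) :
    boxMeasure d a b Set.univ ≤ 1 := by
  rw [boxMeasure, Measure.pi_univ]
  refine Finset.prod_le_one' fun i _ => ?_
  rw [Measure.restrict_apply_univ, Real.volume_Icc]
  simpa using h

/-- The total mass is at most one, so Hölder's inequality costs no constant and the bounds stay
uniform in the box. -/
theorem eLpNorm_boxMeasure_mono {E : Type*} [NormedAddCommGroup E] {d : ℕ} {a b : ℝ}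
    (h : b - a ≤ 1) {p q : ℝ≥0∞} (hpq : p ≤ q) {f : (Fin d → ℝ) → E}
    (hf : AEStronglyMeasurable f (boxMeasure d a b)) :
    eLpNorm f p (boxMeasure d a b) ≤ eLpNorm f q (boxMeasure d a b) := by
  rcases eq_or_ne p 0 with rfl | hp
  · simp
  refine (eLpNorm_le_eLpNorm_mul_rpow_measure_univ hpq hf).trans ?_
  refine mul_le_of_le_one_right' ?_
  refine ENNReal.rpow_le_one (boxMeasure_univ_le_one d h) ?_
  rcases eq_or_ne q ⊤ with rfl | hq
  · simp
  have := ENNReal.toReal_mono hq hpq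
  have := ENNReal.toReal_pos hp (ne_top_of_le_ne_top hq hpq)
  have := one_div_le_one_div_of_le this ‹_›
  linarith

theorem enorm_le_lintegral_line {d : ℕ} {u : (Fin d → ℝ) → ℝ} (hu : ContDiff ℝ 1 u) {a b : ℝ}
    (hab : 1 / 2 ≤ b - a) {x : Fin d → ℝ} (i : Fin d) (hx : x i ∈ Set.Icc a b) :
    ‖u x‖ₑ ≤ ∫⁻ t in Set.Icc a b, (2 * ‖u (Function.update x i t)‖ₑ +
      ‖fderiv ℝ u (Function.update x i t)‖ₑ) := by
  have h1 := enorm_le_lintegral_Icc_add_deriv (v := u ∘ Function.update x i)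
    (hu.comp (by convert! contDiff_update 1 x i)) hab hx
  simp only [Function.comp_apply, Function.update_eq_self] at h1
  refine h1.trans (lintegral_mono fun y => ?_)
  refine add_le_add le_rfl ?_
  calc ‖deriv (u ∘ Function.update x i) y‖ₑ
      = ‖fderiv ℝ u (Function.update x i y) (deriv (Function.update x i) y)‖ₑ := by
        rw [fderiv_comp_deriv _ (hu.differentiable one_ne_zero).differentiableAt
          (hasDerivAt_update x i y).differentiableAt]
    _ ≤ ‖fderiv ℝ u (Function.update x i y)‖ₑ * ‖deriv (Function.update x i) y‖ₑ :=
      ContinuousLinearMap.le_opENorm _ _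
    _ ≤ ‖fderiv ℝ u (Function.update x i y)‖ₑ := by simp [deriv_update, Pi.enorm_single]

/-- Gagliardo's argument: |u x| is bounded by a line integral in each of the d directions. The
product of these bounds, each to the power 1/(d-1), is integrated by the grid-lines lemma
`lintegral_prod_lintegral_pow_le`. -/
theorem lintegral_rpow_le_rpow_lintegral_add_fderiv {d : ℕ} {p : ℝ}
    (hp : Real.HolderConjugate d p) {u : (Fin d → ℝ) → ℝ} (hu : ContDiff ℝ 1 u) {a b : ℝ}
    (hab : 1 / 2 ≤ b - a) :
    ∫⁻ x, ‖u x‖ₑ ^ p ∂boxMeasure d a b ≤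
      (∫⁻ x, (2 * ‖u x‖ₑ + ‖fderiv ℝ u x‖ₑ) ∂boxMeasure d a b) ^ p := by
  have hc := hu.continuous
  have hfc : Continuous (fderiv ℝ u) := hu.continuous_fderiv one_ne_zero
  have hd : (1 : ℝ) < d := hp.lt
  calc ∫⁻ x, ‖u x‖ₑ ^ p ∂boxMeasure d a b
      = ∫⁻ x, ∏ _i : Fin d, ‖u x‖ₑ ^ (1 / (d - 1 : ℝ)) ∂boxMeasure d a b := by
        congr! 2 with x
        simp_rw [Finset.prod_const, Finset.card_univ, Fintype.card_fin]
        rw [← ENNReal.rpow_natCast, ← ENNReal.rpow_mul, hp.conjugate_eq]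
        congr 1
        field_simp
    _ ≤ ∫⁻ x, ∏ i : Fin d, (∫⁻ t in Set.Icc a b, (2 * ‖u (Function.update x i t)‖ₑ +
          ‖fderiv ℝ u (Function.update x i t)‖ₑ)) ^ (1 / (d - 1 : ℝ)) ∂boxMeasure d a b := by
        refine lintegral_mono_ae ?_
        filter_upwards [ae_mem_boxMeasure d a b] with x hx
        refine Finset.prod_le_prod' fun i _ => ?_
        exact ENNReal.rpow_le_rpow (enorm_le_lintegral_line hu hab i (hx i))
          (one_div_nonneg.2 (by linarith))
    _ ≤ _ := by
        have := lintegral_prod_lintegral_pow_le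
          (fun _ : Fin d => (volume : Measure ℝ).restrict (Set.Icc a b)) (p := p)
          (by simpa using hp) (f := fun x => 2 * ‖u x‖ₑ + ‖fderiv ℝ u x‖ₑ) (by fun_prop)
        simpa [boxMeasure] using this

theorem lintegral_rpow_enorm_lt_top {d : ℕ} {u : (Fin d → ℝ) → ℝ} (hc : Continuous u) (a b : ℝ)
    {r : ℝ} (hr : 0 ≤ r) : ∫⁻ x, ‖u x‖ₑ ^ r ∂boxMeasure d a b < ⊤ := by
  obtain ⟨C, hC⟩ := (isCompact_univ_pi fun _ : Fin d => isCompact_Icc (a := a) (b := b)).exists_bound_of_continuousOn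
    hc.continuousOn
  calc ∫⁻ x, ‖u x‖ₑ ^ r ∂boxMeasure d a b ≤ ∫⁻ x, ENNReal.ofReal C ^ r ∂boxMeasure d a b := by
        refine lintegral_mono_ae ?_
        filter_upwards [ae_mem_boxMeasure d a b] with x hx
        refine ENNReal.rpow_le_rpow ?_ hr
        rw [← ofReal_norm]
        exact ENNReal.ofReal_le_ofReal (hC x fun i _ => hx i)
    _ < ⊤ := by
      rw [lintegral_const]
      exact ENNReal.mul_lt_top (ENNReal.rpow_lt_top_of_nonneg hr (by simp)) (measure_lt_top _ _)

/-- The Gagliardo-Nirenberg-Sobolev inequality on a cube of side at least `1/2`. -/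
theorem lintegral_rpow_root_le_of_one_lt {d : ℕ} {p r : ℝ} (hp : 1 < p) (hpd : p < d)
    (hr : 1 / r = 1 / p - 1 / d) {u : (Fin d → ℝ) → ℝ} (hu : ContDiff ℝ 1 u) {a b : ℝ}
    (hab : 1 / 2 ≤ b - a) :
    (∫⁻ x, ‖u x‖ₑ ^ r ∂boxMeasure d a b) ^ (1 / r) ≤
      (2 + ENNReal.ofReal (r * (d - 1) / d)) * ((∫⁻ x, ‖u x‖ₑ ^ p ∂boxMeasure d a b) ^ (1 / p) +
        (∫⁻ x, ‖fderiv ℝ u x‖ₑ ^ p ∂boxMeasure d a b) ^ (1 / p)) := by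
  have hc := hu.continuous
  have hfc : Continuous (fderiv ℝ u) := hu.continuous_fderiv one_ne_zero
  have hp0 : 0 < p := by linarith
  have hd1 : (1 : ℝ) < d := hp.trans hpd
  have hd0 : (0 : ℝ) < d := by linarith
  have hr0 : 0 < r := by
    rw [← one_div_pos, hr]; exact sub_pos.2 (one_div_lt_one_div_of_lt hp0 hpd)
  have hreq : r = p * d / (d - p) := by
    have : d - p ≠ 0 := by linarith
    have h2 : 1 / r = (d - p) / (p * d) := by rw [hr]; field_simp
    rw [← one_div_one_div r, h2, one_div_div]
  have hdp : (0 : ℝ) < d - p := by linarith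
  set n' := Real.conjExponent d with hn'
  have hn : Real.HolderConjugate d n' := .conjExponent hd1
  have hn'e : n' = d / (d - 1) := rfl
  have hd10 : (0 : ℝ) < d - 1 := by linarith
  -- The L¹ inequality will be applied to |u|^γ. This γ makes both γ n' and (γ - 1) q equal to r, so
  -- that the same integral A appears on both sides; γ > 1 keeps |u|^γ of class C¹.
  set γ := r * (d - 1) / d with hγ
  set q := Real.conjExponent p with hq
  have hpq : Real.HolderConjugate p q := .conjExponent hp
  have hqe : q = p / (p - 1) := rfl
  have hp1 : 0 < p - 1 := by linarith
  have h1 : γ * n' = r := by rw [hγ, hn'e]; field_simp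
  have h2 : (γ - 1) * q = r := by rw [hγ, hqe, hreq]; field_simp; ring
  have hγ1 : 1 < γ := by
    have : 0 < (γ - 1) * q := by rw [h2]; exact hr0
    have := (pos_iff_pos_of_mul_pos this).2 hpq.symm.pos
    linarith
  have h3 : 1 / n' - 1 / q = 1 / r := by rw [hr, hn'e, hqe]; field_simp; ring
  set A := ∫⁻ x, ‖u x‖ₑ ^ r ∂boxMeasure d a b with hA
  have hAt : A ≠ ⊤ := (lintegral_rpow_enorm_lt_top hc a b hr0.le).ne
  rcases eq_or_ne A 0 with hA0 | hA0
  · rw [hA0, ENNReal.zero_rpow_of_pos (one_div_pos.2 hr0)]; exact zero_le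
  set μ := boxMeasure d a b with hμ
  have hold : ∀ g : (Fin d → ℝ) → ℝ≥0∞, Measurable g →
      ∫⁻ x, ‖u x‖ₑ ^ (γ - 1) * g x ∂μ ≤ A ^ (1 / q) * (∫⁻ x, g x ^ p ∂μ) ^ (1 / p) := by
    intro g hg
    have := ENNReal.lintegral_mul_le_Lp_mul_Lq μ hpq.symm (f := fun x => ‖u x‖ₑ ^ (γ - 1)) (g := g)
      (by fun_prop) hg.aemeasurable
    simpa only [Pi.mul_apply, ← ENNReal.rpow_mul, h2] using this
  have main : A ^ (1 / n') ≤ A ^ (1 / q) * (2 * (∫⁻ x, ‖u x‖ₑ ^ p ∂μ) ^ (1 / p) +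
      ENNReal.ofReal γ * (∫⁻ x, ‖fderiv ℝ u x‖ₑ ^ p ∂μ) ^ (1 / p)) := by
    have hv : ContDiff ℝ 1 fun x => ‖u x‖ ^ γ := hu.norm_rpow hγ1
    calc A ^ (1 / n') = (∫⁻ x, ‖‖u x‖ ^ γ‖ₑ ^ n' ∂μ) ^ (1 / n') := by
          rw [hA]
          congr 1
          refine lintegral_congr fun x => ?_
          rw [Real.enorm_rpow_of_nonneg (norm_nonneg _) (by linarith), enorm_norm,
            ← ENNReal.rpow_mul, h1]
      _ ≤ ((∫⁻ x, (2 * ‖‖u x‖ ^ γ‖ₑ + ‖fderiv ℝ (fun x => ‖u x‖ ^ γ) x‖ₑ) ∂μ) ^ n') ^ (1 / n') :=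
        ENNReal.rpow_le_rpow (lintegral_rpow_le_rpow_lintegral_add_fderiv hn hv hab)
          (one_div_nonneg.2 hn.symm.nonneg)
      _ = ∫⁻ x, (2 * ‖‖u x‖ ^ γ‖ₑ + ‖fderiv ℝ (fun x => ‖u x‖ ^ γ) x‖ₑ) ∂μ := by
        rw [← ENNReal.rpow_mul, mul_one_div_cancel hn.symm.ne_zero, ENNReal.rpow_one]
      _ ≤ ∫⁻ x, (2 * (‖u x‖ₑ ^ (γ - 1) * ‖u x‖ₑ) +
            ENNReal.ofReal γ * (‖u x‖ₑ ^ (γ - 1) * ‖fderiv ℝ u x‖ₑ)) ∂μ := by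
        refine lintegral_mono fun x => add_le_add ?_ ?_
        · refine mul_le_mul_right (le_of_eq ?_) _
          rw [Real.enorm_rpow_of_nonneg (norm_nonneg _) (by linarith), enorm_norm]
          nth_rw 3 [← ENNReal.rpow_one ‖u x‖ₑ]
          rw [← ENNReal.rpow_add_of_nonneg _ _ (by linarith) zero_le_one, sub_add_cancel]
        · have := enorm_fderiv_norm_rpow_le (hu.differentiable one_ne_zero) (x := x)
            (p := ⟨γ, by linarith⟩) (by exact_mod_cast hγ1)
          rw [← mul_assoc]
          convert! this using 3
          rw [ENNReal.ofReal, Real.toNNReal_of_nonneg (by linarith)]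
          rfl
      _ = 2 * ∫⁻ x, ‖u x‖ₑ ^ (γ - 1) * ‖u x‖ₑ ∂μ +
            ENNReal.ofReal γ * ∫⁻ x, ‖u x‖ₑ ^ (γ - 1) * ‖fderiv ℝ u x‖ₑ ∂μ := by
        rw [lintegral_add_left (by fun_prop), lintegral_const_mul _ (by fun_prop),
          lintegral_const_mul _ (by fun_prop)]
      _ ≤ 2 * (A ^ (1 / q) * (∫⁻ x, ‖u x‖ₑ ^ p ∂μ) ^ (1 / p)) +
            ENNReal.ofReal γ * (A ^ (1 / q) * (∫⁻ x, ‖fderiv ℝ u x‖ₑ ^ p ∂μ) ^ (1 / p)) := by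
        gcongr
        · exact hold _ (by fun_prop)
        · exact hold _ (by fun_prop)
      _ = _ := by ring
  have hq0 : A ^ (1 / q) ≠ 0 := (ENNReal.rpow_pos (pos_iff_ne_zero.2 hA0) hAt).ne'
  have hqt : A ^ (1 / q) ≠ ⊤ := ENNReal.rpow_ne_top_of_nonneg (one_div_nonneg.2 hpq.symm.nonneg) hAt
  -- Dividing by A ^ (1 / q) is legitimate because A is finite (u is bounded on the box) and
  -- nonzero.
  rw [← h3, ENNReal.rpow_sub _ _ hA0 hAt]
  refine ENNReal.div_le_of_le_mul' (main.trans ?_)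
  rw [mul_add (2 + _)]
  gcongr
  · exact le_self_add
  · exact le_add_self

/-- Since L^p norms increase with p on these boxes, p may be lowered and r raised until the pair is
critical with 1 < p < d. In dimension one there is no such p, and the line integral already bounds
the supremum. -/
theorem exists_eLpNorm_le_of_contDiff {d : ℕ} (hd : 0 < d) {p r : ℝ} (hp : 1 < p) (hr : 1 < r)
    (hpr : 1 / p - 1 / d ≤ 1 / r) :
    ∃ C : ℝ≥0∞, C ≠ ⊤ ∧ ∀ a b : ℝ, 1 / 2 ≤ b - a → b - a ≤ 1 → ∀ u : (Fin d → ℝ) → ℝ,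
      ContDiff ℝ 1 u → eLpNorm u (ENNReal.ofReal r) (boxMeasure d a b) ≤
        C * (eLpNorm u (ENNReal.ofReal p) (boxMeasure d a b) +
          eLpNorm (fderiv ℝ u) (ENNReal.ofReal p) (boxMeasure d a b)) := by
  have eL : ∀ {E : Type} [NormedAddCommGroup E] {t : ℝ} (ht : 0 < t) (f : (Fin d → ℝ) → E)
      (μ : Measure (Fin d → ℝ)),
      eLpNorm f (ENNReal.ofReal t) μ = (∫⁻ x, ‖f x‖ₑ ^ t ∂μ) ^ (1 / t) := by
    intro E _ t ht f μ
    rw [eLpNorm_eq_lintegral_rpow_enorm_toReal (by simpa using ht) (by simp),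
      ENNReal.toReal_ofReal ht.le]
  rcases Nat.lt_or_ge 1 d with hd1 | hd1
  · have hd1' : (1 : ℝ) < d := by exact_mod_cast hd1
    have hd0 : (0 : ℝ) < d := by linarith
    have hid : 1 / (d : ℝ) < 1 := by rw [div_lt_one hd0]; exact hd1'
    have hid0 : 0 < 1 / (d : ℝ) := by positivity
    have hip : 1 / p < 1 := by rw [div_lt_one (by linarith)]; exact hp
    have hip0 : 0 < 1 / p := by positivity
    have hir0 : 0 < 1 / r := by positivity
    -- t is the reciprocal of the lowered p; its critical partner has reciprocal t - 1/d ≤ 1/r. The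
    -- midpoint of 1/d and 1 keeps t strictly between the two.
    obtain ⟨t, ht1, ht2, ht3, ht4⟩ : ∃ t : ℝ, 1 / p ≤ t ∧ t < 1 ∧ 1 / d < t ∧ t ≤ 1 / r + 1 / d := by
      refine ⟨max (1 / p) (min (1 / r + 1 / d) ((1 + 1 / d) / 2)), le_max_left _ _,
        max_lt hip (min_lt_of_right_lt (by linarith)),
        lt_max_of_lt_right (lt_min (by linarith) (by linarith)),
        max_le (by linarith) (min_le_left _ _)⟩
    have ht0 : 0 < t := hip0.trans_le ht1
    set p' := 1 / t with hp'
    have hp'1 : 1 < p' := by rw [hp', lt_div_iff₀ ht0]; linarith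
    have hp'd : p' < d := by
      rw [hp', div_lt_iff₀ ht0]
      rw [div_lt_iff₀ hd0] at ht3; linarith
    have hp'p : p' ≤ p := by
      rw [hp', div_le_iff₀ ht0]
      rw [div_le_iff₀ (by linarith)] at ht1; linarith
    set r' := 1 / (t - 1 / d) with hr'
    have htd : 0 < t - 1 / d := by linarith
    have hrr' : r ≤ r' := by
      rw [hr', le_div_iff₀ htd]
      calc r * (t - 1 / d) ≤ r * (1 / r) := by gcongr; linarith
        _ = 1 := by field_simp
    have hr'0 : 0 < r' := by linarith
    refine ⟨2 + ENNReal.ofReal (r' * (d - 1) / d), by simp, fun a b hab hab' u hu => ?_⟩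
    have hc := hu.continuous
    have hfc : Continuous (fderiv ℝ u) := hu.continuous_fderiv one_ne_zero
    calc eLpNorm u (ENNReal.ofReal r) (boxMeasure d a b)
        ≤ eLpNorm u (ENNReal.ofReal r') (boxMeasure d a b) :=
          eLpNorm_boxMeasure_mono hab' (ENNReal.ofReal_le_ofReal hrr') hc.aestronglyMeasurable
      _ ≤ (2 + ENNReal.ofReal (r' * (d - 1) / d)) *
          (eLpNorm u (ENNReal.ofReal p') (boxMeasure d a b) +
          eLpNorm (fderiv ℝ u) (ENNReal.ofReal p') (boxMeasure d a b)) := by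
          rw [eL hr'0, eL (by linarith), eL (by linarith)]
          exact lintegral_rpow_root_le_of_one_lt hp'1 hp'd (by simp [hr', hp']) hu hab
      _ ≤ _ := by
          gcongr <;>
          exact eLpNorm_boxMeasure_mono hab' (ENNReal.ofReal_le_ofReal hp'p)
            (by fun_prop)
  · obtain rfl : d = 1 := by omega
    refine ⟨2, by simp, fun a b hab hab' u hu => ?_⟩
    have hc := hu.continuous
    have hfc : Continuous (fderiv ℝ u) := hu.continuous_fderiv one_ne_zero
    set μ := boxMeasure 1 a b with hμ
    have h1 : ∀ᵐ x ∂μ, ‖u x‖ₑ ≤ ∫⁻ x, (2 * ‖u x‖ₑ + ‖fderiv ℝ u x‖ₑ) ∂μ := by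
      filter_upwards [ae_mem_boxMeasure 1 a b] with x hx
      -- In dimension one the single line through x is the whole box.
      refine (enorm_le_lintegral_line hu hab 0 (hx 0)).trans (le_of_eq ?_)
      have e1 := congrFun (lmarginal_singleton
        (μ := fun _ : Fin 1 => (volume : Measure ℝ).restrict (Set.Icc a b))
        (fun x => 2 * ‖u x‖ₑ + ‖fderiv ℝ u x‖ₑ) 0) x
      have e2 : ({0} : Finset (Fin 1)) = Finset.univ := rfl
      rw [e2, lmarginal_univ] at e1
      exact e1.symm
    have h2 : eLpNorm u ⊤ μ ≤ ∫⁻ x, (2 * ‖u x‖ₑ + ‖fderiv ℝ u x‖ₑ) ∂μ := by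
      rw [eLpNorm_exponent_top]
      exact eLpNormEssSup_le_of_ae_enorm_bound h1
    calc eLpNorm u (ENNReal.ofReal r) μ ≤ eLpNorm u ⊤ μ :=
          eLpNorm_boxMeasure_mono hab' le_top hc.aestronglyMeasurable
      _ ≤ ∫⁻ x, (2 * ‖u x‖ₑ + ‖fderiv ℝ u x‖ₑ) ∂μ := h2
      _ = 2 * eLpNorm u 1 μ + eLpNorm (fderiv ℝ u) 1 μ := by
          rw [lintegral_add_left (by fun_prop), lintegral_const_mul _ (by fun_prop),
            eLpNorm_one_eq_lintegral_enorm, eLpNorm_one_eq_lintegral_enorm]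
      _ ≤ 2 * eLpNorm u (ENNReal.ofReal p) μ + 2 * eLpNorm (fderiv ℝ u) (ENNReal.ofReal p) μ := by
          have h1p : 1 ≤ ENNReal.ofReal p := by simpa using hp.le
          refine add_le_add (mul_le_mul_right (eLpNorm_boxMeasure_mono hab' h1p
            hc.aestronglyMeasurable) _) ?_
          refine (eLpNorm_boxMeasure_mono hab' h1p hfc.aestronglyMeasurable).trans ?_
          exact le_mul_of_one_le_left' (by norm_num)
      _ = _ := by ring

end ControlVariate

/-! ### Mollification and the first-order embedding for weak derivatives -/

/-- Jensen's inequality, as Hölder against the constant 1. -/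
theorem ENNReal.lintegral_le_rpow_lintegral_rpow {α : Type*} [MeasurableSpace α] (μ : Measure α)
    [IsProbabilityMeasure μ] {p : ℝ} (hp : 1 ≤ p) {f : α → ℝ≥0∞} (hf : AEMeasurable f μ) :
    ∫⁻ x, f x ∂μ ≤ (∫⁻ x, f x ^ p ∂μ) ^ (1 / p) := by
  rcases hp.eq_or_lt with rfl | hp
  · simp
  have := ENNReal.lintegral_mul_le_Lp_mul_Lq μ (Real.HolderConjugate.conjExponent hp) hf
    (g := fun _ => 1) aemeasurable_const
  simpa using this

namespace ControlVariate

open scoped Convolution Topology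

/-- Convolution with a nonnegative mollifier is a contraction of `L^p`. -/
theorem eLpNorm_bump_convolution_le {d : ℕ} (ρ : ContDiffBump (0 : Fin d → ℝ)) {p : ℝ}
    (hp : 1 ≤ p) {g : (Fin d → ℝ) → ℝ} (hg : AEStronglyMeasurable g volume) :
    eLpNorm (ρ.normed volume ⋆[ContinuousLinearMap.lsmul ℝ ℝ, volume] g) (ENNReal.ofReal p)
      volume ≤ eLpNorm g (ENNReal.ofReal p) volume := by
  have hp0 : 0 < p := by linarith
  set w : (Fin d → ℝ) → ℝ := ρ.normed volume with hw
  have hwc : Continuous w := ρ.continuous_normed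
  have hw0 : ∀ x, 0 ≤ w x := ρ.nonneg_normed
  -- With the mollifier as a probability density, the convolution is an average of translates:
  -- Jensen pointwise, then Tonelli and translation invariance.
  set π : Measure (Fin d → ℝ) := volume.withDensity fun t => ENNReal.ofReal (w t) with hπ
  have hπ1 : IsProbabilityMeasure π := by
    constructor
    rw [hπ, withDensity_apply _ MeasurableSet.univ, Measure.restrict_univ,
      ← ofReal_integral_eq_lintegral_ofReal ρ.integrable_normed (Filter.Eventually.of_forall hw0),
      ρ.integral_normed, ENNReal.ofReal_one]
  have hmeas : AEStronglyMeasurable (fun z : (Fin d → ℝ) × (Fin d → ℝ) => g (z.1 - z.2))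
      (volume.prod π) :=
    hg.comp_quasiMeasurePreserving (quasiMeasurePreserving_sub_of_right_invariant volume π)
  have hmx : ∀ x : Fin d → ℝ, AEMeasurable (fun t => ‖g (x - t)‖ₑ) π := by
    intro x
    have h1 : AEStronglyMeasurable (fun t => g (x - t)) volume :=
      hg.comp_quasiMeasurePreserving
        (Measure.measurePreserving_sub_left volume x).quasiMeasurePreserving
    exact (h1.mono_ac (withDensity_absolutelyContinuous _ _)).enorm
  have hpt : ∀ x, ‖(w ⋆[ContinuousLinearMap.lsmul ℝ ℝ, volume] g) x‖ₑ ^ p ≤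
      ∫⁻ t, ‖g (x - t)‖ₑ ^ p ∂π := by
    intro x
    have h1 : ‖(w ⋆[ContinuousLinearMap.lsmul ℝ ℝ, volume] g) x‖ₑ ≤ ∫⁻ t, ‖g (x - t)‖ₑ ∂π := by
      rw [MeasureTheory.convolution_def]
      refine (enorm_integral_le_lintegral_enorm _).trans (le_of_eq ?_)
      rw [hπ, lintegral_withDensity_eq_lintegral_mul₀' (by fun_prop) (hmx x)]
      refine lintegral_congr fun t => ?_
      simp only [ContinuousLinearMap.lsmul_apply, smul_eq_mul, enorm_mul, Pi.mul_apply]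
      rw [Real.enorm_of_nonneg (hw0 t)]
    calc _ ≤ (∫⁻ t, ‖g (x - t)‖ₑ ∂π) ^ p := by gcongr
      _ ≤ ((∫⁻ t, ‖g (x - t)‖ₑ ^ p ∂π) ^ (1 / p)) ^ p := by
        gcongr
        exact ENNReal.lintegral_le_rpow_lintegral_rpow π hp (hmx x)
      _ = _ := by rw [← ENNReal.rpow_mul, one_div_mul_cancel hp0.ne', ENNReal.rpow_one]
  rw [eLpNorm_eq_lintegral_rpow_enorm_toReal (by simpa using hp0) (by simp),
    eLpNorm_eq_lintegral_rpow_enorm_toReal (by simpa using hp0) (by simp),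
    ENNReal.toReal_ofReal hp0.le]
  refine ENNReal.rpow_le_rpow ?_ (by positivity)
  calc _ ≤ ∫⁻ x, ∫⁻ t, ‖g (x - t)‖ₑ ^ p ∂π := lintegral_mono hpt
    _ = ∫⁻ t, ∫⁻ x, ‖g (x - t)‖ₑ ^ p ∂volume ∂π :=
      lintegral_lintegral_swap (hmeas.enorm.pow_const p)
    _ = ∫⁻ t, ∫⁻ x, ‖g x‖ₑ ^ p ∂volume ∂π := by
      refine lintegral_congr fun t => ?_
      exact lintegral_sub_right_eq_self (fun x => ‖g x‖ₑ ^ p) t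
    _ = _ := by simp

theorem ae_mem_openCube (d : ℕ) : ∀ᵐ x ∂unif d, x ∈ openCube d := by
  have h : (openCube d : Set (Fin d → ℝ)) =ᵐ[volume] cube d :=
    Measure.univ_pi_Ioo_ae_eq_Icc (μ := fun _ => volume) (f := 0) (g := 1)
  rw [unif, ← Measure.restrict_congr_set h]
  exact ae_restrict_mem (MeasurableSet.univ_pi fun _ => measurableSet_Ioo)

theorem openCube_subset_cube (d : ℕ) : openCube d ⊆ cube d :=
  fun _ hx => ⟨fun i => (hx i trivial).1.le, fun i => (hx i trivial).2.le⟩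

theorem measurableSet_cube (d : ℕ) : MeasurableSet (cube d) := measurableSet_Icc

instance (d : ℕ) : IsProbabilityMeasure (unif d) := by
  constructor
  rw [unif, Measure.restrict_apply_univ, cube, Real.volume_Icc_pi]
  simp

theorem eLpNorm_indicator_cube {d : ℕ} (f : (Fin d → ℝ) → ℝ) (p : ℝ≥0∞) :
    eLpNorm ((cube d).indicator f) p volume = eLpNorm f p (unif d) :=
  eLpNorm_indicator_eq_eLpNorm_restrict (measurableSet_cube d)

theorem integrable_indicator_cube {d : ℕ} {f : (Fin d → ℝ) → ℝ} {p : ℝ} (hp : 1 ≤ p)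
    (hf : MemLp f (ENNReal.ofReal p) (unif d)) : Integrable ((cube d).indicator f) volume :=
  (integrable_indicator_iff (measurableSet_cube d)).2 (hf.integrable (by simpa using hp))

/-- Mollification commutes with weak derivatives at a positive distance from the boundary. -/
theorem fderiv_bump_convolution_apply {d : ℕ} (ρ : ContDiffBump (0 : Fin d → ℝ)) {p : ℝ}
    (hp : 1 ≤ p) {f g : (Fin d → ℝ) → ℝ} (hf : MemLp f (ENNReal.ofReal p) (unif d)) (i : Fin d)
    (hfg : IsWeakDeriv (fun _ : Fin 1 => i) f g) {x : Fin d → ℝ} {δ : ℝ} (hδ : ρ.rOut < δ)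
    (hx : ∀ j, x j ∈ Set.Icc δ (1 - δ)) :
    fderiv ℝ (ρ.normed volume ⋆[ContinuousLinearMap.lsmul ℝ ℝ, volume] (cube d).indicator f) x
      (Pi.single i 1) =
    (ρ.normed volume ⋆[ContinuousLinearMap.lsmul ℝ ℝ, volume] (cube d).indicator g) x := by
  set w : (Fin d → ℝ) → ℝ := ρ.normed volume with hw
  have hwd : ContDiff ℝ ∞ w := ρ.contDiff_normed
  have hwc : HasCompactSupport w := ρ.hasCompactSupport_normed
  have hfi := integrable_indicator_cube hp hf
  have hw1 : ContDiff ℝ 1 w := hwd.of_le (by exact_mod_cast le_top)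
  have hder := (hwc.hasFDerivAt_convolution_left (ContinuousLinearMap.lsmul ℝ ℝ) hw1
    hfi.locallyIntegrable x).fderiv
  have hex : Integrable (fun t => (ContinuousLinearMap.precompL (Fin d → ℝ)
      (ContinuousLinearMap.lsmul ℝ ℝ : ℝ →L[ℝ] ℝ →L[ℝ] ℝ) (fderiv ℝ w t))
        ((cube d).indicator f (x - t))) volume :=
    (hwc.fderiv ℝ).convolutionExists_left (ContinuousLinearMap.precompL (Fin d → ℝ)
      (ContinuousLinearMap.lsmul ℝ ℝ : ℝ →L[ℝ] ℝ →L[ℝ] ℝ)) (hw1.continuous_fderiv one_ne_zero)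
      hfi.locallyIntegrable x
  rw [hder, MeasureTheory.convolution_def, ContinuousLinearMap.integral_apply hex]
  simp only [ContinuousLinearMap.precompL_apply, ContinuousLinearMap.lsmul_apply, smul_eq_mul]
  -- The reflected, translated mollifier is supported within `ρ.rOut` < δ of x, hence is a test
  -- function on the open cube. The sign from the reflection will cancel the one in the weak
  -- derivative.
  set φ : (Fin d → ℝ) → ℝ := fun y => w (x - y) with hφ
  have hφd : ContDiff ℝ ∞ φ := hwd.comp (contDiff_const.sub contDiff_id)
  have hsupp : Function.support φ ⊆ Metric.closedBall x ρ.rOut := by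
    intro y hy
    have : x - y ∈ Function.support w := hy
    rw [hw, ρ.support_normed_eq, mem_ball_zero_iff] at this
    rw [Metric.mem_closedBall, dist_comm, dist_eq_norm]
    exact this.le
  have htsupp : tsupport φ ⊆ Metric.closedBall x ρ.rOut :=
    closure_minimal hsupp Metric.isClosed_closedBall
  have htest : IsTestFunction φ := by
    refine ⟨hφd, HasCompactSupport.of_support_subset_isCompact (isCompact_closedBall x ρ.rOut)
      hsupp, htsupp.trans ?_⟩
    intro y hy j _
    have h1 : |y j - x j| ≤ ρ.rOut := (dist_le_pi_dist y x j).trans hy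
    have h2 := abs_le.1 h1
    have h3 := hx j
    constructor <;> linarith [h3.1, h3.2]
  have hpd : ∀ y, partialDeriv (fun _ : Fin 1 => i) φ y = - fderiv ℝ w (x - y) (Pi.single i 1) := by
    intro y
    rw [partialDeriv, iteratedFDeriv_one_apply]
    have h1 : HasFDerivAt (fun y : Fin d → ℝ => x - y)
        (-(ContinuousLinearMap.id ℝ (Fin d → ℝ))) y := by
      simpa using (hasFDerivAt_id (𝕜 := ℝ) y).const_sub x
    have h2 := ((hw1.differentiable one_ne_zero) (x - y)).hasFDerivAt.comp y h1
    rw [show φ = w ∘ fun y => x - y from rfl, h2.fderiv]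
    simp
  have hweak := hfg φ htest
  simp only [hpd] at hweak
  have e1 : ∫ t, fderiv ℝ w t (Pi.single i 1) * (cube d).indicator f (x - t) =
      ∫ y in cube d, f y * fderiv ℝ w (x - y) (Pi.single i 1) := by
    rw [← integral_sub_left_eq_self _ volume x, ← integral_indicator (measurableSet_cube d)]
    refine integral_congr_ae (Filter.Eventually.of_forall fun y => ?_)
    simp only [sub_sub_cancel]
    by_cases hy : y ∈ cube d
    · simp [hy, mul_comm]
    · simp [hy]
  have e2 : (∫ t, w t * (cube d).indicator g (x - t)) = ∫ y in cube d, g y * φ y := by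
    rw [← integral_sub_left_eq_self _ volume x, ← integral_indicator (measurableSet_cube d)]
    refine integral_congr_ae (Filter.Eventually.of_forall fun y => ?_)
    simp only [sub_sub_cancel]
    by_cases hy : y ∈ cube d
    · simp [hy, mul_comm, hφ]
    · simp [hy]
  rw [e1, MeasureTheory.convolution_def]
  simp only [ContinuousLinearMap.lsmul_apply, smul_eq_mul]
  rw [e2]
  simp only [mul_neg, integral_neg, pow_one, neg_mul, one_mul, neg_inj] at hweak
  exact hweak

/-- The norm on `Fin d → ℝ` is the supremum norm, dual to the ℓ¹ norm; thus partial derivatives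
control `fderiv`. -/
theorem enorm_clm_pi_le_sum {d : ℕ} (L : (Fin d → ℝ) →L[ℝ] ℝ) :
    ‖L‖ₑ ≤ ∑ i, ‖L (Pi.single i 1)‖ₑ := by
  have h : ‖L‖ ≤ ∑ i, ‖L (Pi.single i 1)‖ := by
    refine L.opNorm_le_bound (Finset.sum_nonneg fun i _ => norm_nonneg _) fun v => ?_
    conv_lhs => rw [← L.coe_coe, L.toLinearMap.pi_apply_eq_sum_univ v]
    rw [Finset.sum_mul]
    refine (norm_sum_le _ _).trans (Finset.sum_le_sum fun i _ => ?_)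
    rw [norm_smul, mul_comm]
    have : (fun j => if i = j then (1 : ℝ) else 0) = Pi.single i 1 := by
      ext j; simp [Pi.single_apply, eq_comm]
    rw [this]
    exact mul_le_mul_of_nonneg_left (norm_le_pi_norm v i) (norm_nonneg _)
  rw [← ofReal_norm]
  refine (ENNReal.ofReal_le_ofReal h).trans (le_of_eq ?_)
  rw [ENNReal.ofReal_sum_of_nonneg fun i _ => norm_nonneg _]
  simp only [ofReal_norm]

/-- The first-order Sobolev embedding on the unit cube. -/
theorem exists_eLpNorm_le_of_isWeakDeriv {d : ℕ} (hd : 0 < d) {p r : ℝ} (hp : 1 < p) (hr : 1 < r)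
    (hpr : 1 / p - 1 / d ≤ 1 / r) :
    ∃ C : ℝ≥0∞, C ≠ ⊤ ∧ ∀ (f : (Fin d → ℝ) → ℝ) (g : Fin d → (Fin d → ℝ) → ℝ),
      MemLp f (ENNReal.ofReal p) (unif d) → (∀ i, MemLp (g i) (ENNReal.ofReal p) (unif d)) →
      (∀ i, IsWeakDeriv (fun _ : Fin 1 => i) f (g i)) →
      eLpNorm f (ENNReal.ofReal r) (unif d) ≤
        C * (eLpNorm f (ENNReal.ofReal p) (unif d) +
          ∑ i, eLpNorm (g i) (ENNReal.ofReal p) (unif d)) := by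
  obtain ⟨C, hC, H⟩ := exists_eLpNorm_le_of_contDiff hd hp hr hpr
  refine ⟨C, hC, fun f g hf hg hfg => ?_⟩
  -- The 4 ensures δ n ≤ 1/4, so the shrunken cube [δ n, 1 - δ n]^d still has side at least 1/2.
  set δ : ℕ → ℝ := fun n => 1 / (n + 4) with hδ
  have hδ0 : ∀ n, 0 < δ n := fun n => by simp only [hδ]; positivity
  have hδ1 : ∀ n, δ n ≤ 1 / 4 := fun n => by
    simp only [hδ]
    exact one_div_le_one_div_of_le (by norm_num) (by linarith [(Nat.cast_nonneg n : (0 : ℝ) ≤ n)])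
  have hδt : Filter.Tendsto δ Filter.atTop (𝓝 0) := by
    have h := (tendsto_one_div_add_atTop_nhds_zero_nat (𝕜 := ℝ)).comp (Filter.tendsto_add_atTop_nat 3)
    refine h.congr fun n => ?_
    simp only [Function.comp_apply, hδ]; push_cast; ring
  -- The outer radius is below δ n, to stay inside the cube; the fixed ratio 2 of the radii is what
  -- almost everywhere convergence of the mollifications requires.
  let ρ : ℕ → ContDiffBump (0 : Fin d → ℝ) := fun n =>
    { rIn := δ n / 4
      rOut := δ n / 2
      rIn_pos := by linarith [hδ0 n]
      rIn_lt_rOut := by linarith [hδ0 n] }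
  set F := (cube d).indicator f with hF
  have hFi : Integrable F volume := integrable_indicator_cube hp.le hf
  set u : ℕ → (Fin d → ℝ) → ℝ := fun n =>
    (ρ n).normed volume ⋆[ContinuousLinearMap.lsmul ℝ ℝ, volume] F with hu
  have hud : ∀ n, ContDiff ℝ 1 (u n) := fun n =>
    ((ρ n).hasCompactSupport_normed).contDiff_convolution_left (ContinuousLinearMap.lsmul ℝ ℝ)
      (ρ n).contDiff_normed (n := 1) hFi.locallyIntegrable
  have hlim : ∀ᵐ x ∂(volume : Measure (Fin d → ℝ)),
      Filter.Tendsto (fun n => u n x) Filter.atTop (𝓝 (F x)) := by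
    refine ContDiffBump.ae_convolution_tendsto_right_of_locallyIntegrable (K := 2) ?_ ?_
      hFi.locallyIntegrable
    · simpa [ρ] using hδt.div_const 2
    · refine Filter.Eventually.of_forall fun n => ?_
      simp only [ρ]; linarith
  set S : ℕ → Set (Fin d → ℝ) := fun n => Set.univ.pi fun _ => Set.Icc (δ n) (1 - δ n) with hS
  have hSm : ∀ n, MeasurableSet (S n) := fun n => MeasurableSet.univ_pi fun _ => measurableSet_Icc
  have hSle : ∀ n (h : (Fin d → ℝ) → ℝ),
      eLpNorm h (ENNReal.ofReal p) (boxMeasure d (δ n) (1 - δ n)) ≤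
        eLpNorm h (ENNReal.ofReal p) volume := fun n h => by
    rw [boxMeasure_eq_restrict]
    exact eLpNorm_mono_measure _ Measure.restrict_le_self
  have hbound : ∀ n, eLpNorm ((S n).indicator (u n)) (ENNReal.ofReal r) (unif d) ≤
      C * (eLpNorm f (ENNReal.ofReal p) (unif d) +
          ∑ i, eLpNorm (g i) (ENNReal.ofReal p) (unif d)) := by
    intro n
    rw [eLpNorm_indicator_eq_eLpNorm_restrict (hSm n)]
    have h1 : (unif d).restrict (S n) ≤ boxMeasure d (δ n) (1 - δ n) := by
      rw [boxMeasure_eq_restrict]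
      exact Measure.restrict_mono_measure Measure.restrict_le_self _
    refine (eLpNorm_mono_measure _ h1).trans ?_
    refine (H _ _ (by linarith [hδ1 n]) (by linarith [hδ0 n]) (u n) (hud n)).trans ?_
    gcongr
    · refine (hSle n _).trans ?_
      refine (eLpNorm_bump_convolution_le (ρ n) hp.le hFi.aestronglyMeasurable).trans ?_
      rw [hF, eLpNorm_indicator_cube]
    · set G : Fin d → (Fin d → ℝ) → ℝ := fun i =>
        (ρ n).normed volume ⋆[ContinuousLinearMap.lsmul ℝ ℝ, volume] (cube d).indicator (g i) with hG
      have hGi : ∀ i, Integrable ((cube d).indicator (g i)) volume := fun i =>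
        integrable_indicator_cube hp.le (hg i)
      have hGc : ∀ i, Continuous (G i) := fun i =>
        (((ρ n).hasCompactSupport_normed).contDiff_convolution_left
          (ContinuousLinearMap.lsmul ℝ ℝ) (ρ n).contDiff_normed (n := 0)
          (hGi i).locallyIntegrable).continuous
      calc eLpNorm (fderiv ℝ (u n)) (ENNReal.ofReal p) (boxMeasure d (δ n) (1 - δ n))
          ≤ eLpNorm (∑ i, fun x => ‖G i x‖) (ENNReal.ofReal p)
              (boxMeasure d (δ n) (1 - δ n)) := by
            refine eLpNorm_mono_enorm_ae ?_
            filter_upwards [ae_mem_boxMeasure d (δ n) (1 - δ n)] with x hx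
            refine (enorm_clm_pi_le_sum _).trans (le_of_eq ?_)
            rw [Finset.sum_apply, Real.enorm_of_nonneg (Finset.sum_nonneg fun i _ => norm_nonneg _),
              ENNReal.ofReal_sum_of_nonneg fun i _ => norm_nonneg _]
            refine Finset.sum_congr rfl fun i _ => ?_
            rw [ofReal_norm, hu, fderiv_bump_convolution_apply (ρ n) hp.le hf i (hfg i)
              (δ := δ n) (by simp only [ρ]; linarith [hδ0 n]) hx]
        _ ≤ ∑ i, eLpNorm (fun x => ‖G i x‖) (ENNReal.ofReal p)
              (boxMeasure d (δ n) (1 - δ n)) :=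
            eLpNorm_sum_le (fun i _ => (hGc i).norm.aestronglyMeasurable) (by simpa using hp.le)
        _ ≤ _ := by
            refine Finset.sum_le_sum fun i _ => ?_
            rw [eLpNorm_norm]
            refine (hSle n _).trans ?_
            refine (eLpNorm_bump_convolution_le (ρ n) hp.le (hGi i).aestronglyMeasurable).trans ?_
            rw [eLpNorm_indicator_cube]
  have hlim' : ∀ᵐ x ∂unif d,
      Filter.Tendsto (fun n => (S n).indicator (u n) x) Filter.atTop (𝓝 (f x)) := by
    filter_upwards [ae_mem_openCube d, ae_restrict_of_ae hlim] with x hx hx2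
    have hFx : F x = f x := Set.indicator_of_mem (openCube_subset_cube d hx) _
    rw [← hFx]
    have hev : ∀ᶠ n in Filter.atTop, x ∈ S n := by
      have : ∀ i : Fin d, ∀ᶠ n in Filter.atTop, x i ∈ Set.Icc (δ n) (1 - δ n) := by
        intro i
        have hi := hx i trivial
        filter_upwards [hδt.eventually (gt_mem_nhds hi.1),
          hδt.eventually (gt_mem_nhds (sub_pos.2 hi.2))] with n h1 h2
        constructor <;> linarith
      filter_upwards [Filter.eventually_all.2 this] with n hn i _
      exact hn i
    refine hx2.congr' ?_
    filter_upwards [hev] with n hn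
    rw [Set.indicator_of_mem hn]
  -- Fatou: the cut-off mollifications converge almost everywhere to f, and their norms are
  -- uniformly bounded.
  refine (Lp.eLpNorm_lim_le_liminf_eLpNorm (fun n => ?_) f hlim').trans ?_
  · exact ((hud n).continuous.aestronglyMeasurable).indicator (hSm n)
  · refine Filter.liminf_le_of_le (by isBoundedDefault) fun b hb => ?_
    obtain ⟨n, hn⟩ := hb.exists
    exact hn.trans (hbound n)

end ControlVariate

/-! ### Iterated weak derivatives and the embedding of higher order -/

namespace ControlVariate

theorem IsTestFunction.fderiv_apply {d : ℕ} {φ : (Fin d → ℝ) → ℝ} (hφ : IsTestFunction φ)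
    (v : Fin d → ℝ) : IsTestFunction fun y => fderiv ℝ φ y v := by
  obtain ⟨h1, h2, h3⟩ := hφ
  refine ⟨?_, h2.fderiv_apply ℝ v, ?_⟩
  · exact (h1.fderiv_right (m := ∞) (by simp)).clm_apply contDiff_const
  · refine subset_trans (closure_minimal ?_ (isClosed_tsupport φ)) h3
    intro y hy
    have : fderiv ℝ φ y ≠ 0 := by
      rintro h
      simp [h] at hy
    exact support_fderiv_subset ℝ this

/-- `iteratedFDeriv_succ_apply_right` peels off the innermost derivative, which sits in the last
slot; hence `Fin.snoc`. -/
theorem partialDeriv_snoc {d k : ℕ} (i : Fin k → Fin d) (j : Fin d) {φ : (Fin d → ℝ) → ℝ}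
    (hφ : ContDiff ℝ ∞ φ) (x : Fin d → ℝ) :
    partialDeriv (Fin.snoc i j : Fin (k + 1) → Fin d) φ x =
      partialDeriv i (fun y => fderiv ℝ φ y (Pi.single j 1)) x := by
  rw [partialDeriv, iteratedFDeriv_succ_apply_right]
  have h := (ContinuousLinearMap.apply ℝ ℝ (Pi.single j 1 : Fin d → ℝ)).iteratedFDeriv_comp_left
    (f := fderiv ℝ φ) (x := x) (n := ∞) (i := k)
    (hφ.fderiv_right (m := ∞) (by simp)).contDiffAt (by exact_mod_cast le_top)
  have h' : ((ContinuousLinearMap.apply ℝ ℝ (Pi.single j 1 : Fin d → ℝ)) ∘ fderiv ℝ φ) =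
    fun y => fderiv ℝ φ y (Pi.single j 1) := rfl
  rw [partialDeriv, ← h', h]
  simp only [Fin.snoc_last, ContinuousLinearMap.compContinuousMultilinearMap_coe,
    Function.comp_apply, ContinuousLinearMap.apply_apply]
  congr 2
  ext t
  simp [Fin.init]

/-- The weak derivative of a weak derivative. -/
theorem IsWeakDeriv.snoc {d k : ℕ} {i : Fin k → Fin d} {j : Fin d} {f g g' : (Fin d → ℝ) → ℝ}
    (hg : IsWeakDeriv i f g) (hg' : IsWeakDeriv (Fin.snoc i j : Fin (k + 1) → Fin d) f g') :
    IsWeakDeriv (fun _ : Fin 1 => j) g g' := by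
  intro φ hφ
  -- The order-k identity is tested against ∂_j φ, again a test function, and compared with the
  -- order-(k+1) identity for φ.
  have h1 := hg _ (hφ.fderiv_apply (Pi.single j 1))
  have h2 := hg' φ hφ
  simp only [partialDeriv_snoc i j hφ.1] at h2
  have h3 : ∀ x, partialDeriv (fun _ : Fin 1 => j) φ x = fderiv ℝ φ x (Pi.single j 1) := by
    intro x
    rw [partialDeriv, iteratedFDeriv_one_apply]
  simp only [h3]
  rw [h1, pow_succ] at h2
  have hk : ((-1 : ℝ) ^ k) ≠ 0 := pow_ne_zero _ (by norm_num)
  rw [pow_one]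
  apply mul_left_cancel₀ hk
  rw [h2, mul_assoc]

/-- The fundamental lemma of the calculus of variations on the open cube, whose boundary is null. It
is needed because `sobolevBall` bounds the norm of f only through an order-zero weak derivative. -/
theorem IsWeakDeriv.ae_eq {d : ℕ} {i : Fin 0 → Fin d} {f g : (Fin d → ℝ) → ℝ} {p : ℝ}
    (hp : 1 ≤ p) (hf : MemLp f (ENNReal.ofReal p) (unif d))
    (hg : MemLp g (ENNReal.ofReal p) (unif d)) (h : IsWeakDeriv i f g) : f =ᵐ[unif d] g := by
  have hp' : 1 ≤ ENNReal.ofReal p := by simpa using hp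
  have hfi : Integrable f (unif d) := hf.integrable hp'
  have hgi : Integrable g (unif d) := hg.integrable hp'
  have hopen : IsOpen (openCube d) := isOpen_set_pi Set.finite_univ fun _ _ => isOpen_Ioo
  have hint : IntegrableOn (f - g) (openCube d) volume :=
    (IntegrableOn.mono_set (hfi.sub hgi) (openCube_subset_cube d))
  have key := hopen.ae_eq_zero_of_integral_contDiff_smul_eq_zero (f := f - g)
    hint.locallyIntegrableOn (fun φ hφ hφc hφs => by
      have h1 := h φ ⟨hφ, hφc, hφs⟩
      simp only [partialDeriv, iteratedFDeriv_zero_apply, pow_zero, one_mul] at h1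
      obtain ⟨B, hB⟩ := hφc.exists_bound_of_continuous hφ.continuous
      have i1 : Integrable (fun x => f x * φ x) (unif d) :=
        hfi.mul_bdd hφ.continuous.aestronglyMeasurable (Filter.Eventually.of_forall hB)
      have i2 : Integrable (fun x => g x * φ x) (unif d) :=
        hgi.mul_bdd hφ.continuous.aestronglyMeasurable (Filter.Eventually.of_forall hB)
      calc ∫ x, φ x • (f - g) x = ∫ x in cube d, φ x • (f - g) x := by
            refine (setIntegral_eq_integral_of_forall_compl_eq_zero fun x hx => ?_).symm
            have : φ x = 0 := by
              by_contra h0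
              exact hx (openCube_subset_cube d (hφs (subset_tsupport _ h0)))
            simp [this]
        _ = ∫ x in cube d, (f x * φ x - g x * φ x) := by
            congr 1; ext x; simp [mul_sub, mul_comm]
        _ = 0 := by
            exact (integral_sub i1 i2).trans (sub_eq_zero.2 h1))
  filter_upwards [ae_mem_openCube d, ae_restrict_of_ae key] with x hx hx2
  exact sub_eq_zero.1 (hx2 hx)

/-- The first-order embedding applies to each weak derivative of order at most s, whose own first
derivatives are weak derivatives of f of one order more. The factor 1 + d counts the function and
its d partial derivatives. -/
theorem exists_sobolevBall_succ_subset {d s : ℕ} (hd : 0 < d) {p r : ℝ} (hp : 1 < p) (hr : 1 < r)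
    (hpr : 1 / p - 1 / d ≤ 1 / r) (R : ℝ) :
    ∃ R', sobolevBall d (s + 1) p R ⊆ sobolevBall d s r R' := by
  obtain ⟨C, hC, H⟩ := exists_eLpNorm_le_of_isWeakDeriv hd hp hr hpr
  refine ⟨C.toReal * ((1 + d) * R), fun f hf => ?_⟩
  have hfin : ∀ (f : (Fin d → ℝ) → ℝ) (g : Fin d → (Fin d → ℝ) → ℝ),
      MemLp f (ENNReal.ofReal p) (unif d) → (∀ i, MemLp (g i) (ENNReal.ofReal p) (unif d)) →
      (∀ i, IsWeakDeriv (fun _ : Fin 1 => i) f (g i)) →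
      MemLp f (ENNReal.ofReal r) (unif d) := by
    intro f g hf hg hfg
    refine ⟨hf.1, (H f g hf hg hfg).trans_lt ?_⟩
    exact ENNReal.mul_lt_top hC.lt_top
      (ENNReal.add_lt_top.2 ⟨hf.2, ENNReal.sum_lt_top.2 fun i _ => (hg i).2⟩)
  refine ⟨?_, fun k hk i => ?_⟩
  · choose g hg1 hg2 hg3 using fun i : Fin d => hf.2 1 (by omega) (fun _ => i)
    exact hfin f g hf.1 hg1 hg2
  · obtain ⟨g, hg1, hg2, hg3⟩ := hf.2 k (by omega) i
    choose g' hg1' hg2' hg3' using fun j : Fin d => hf.2 (k + 1) (by omega) (Fin.snoc i j)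
    have hw : ∀ j, IsWeakDeriv (fun _ : Fin 1 => j) g (g' j) := fun j => hg2.snoc (hg2' j)
    refine ⟨g, hfin g g' hg1 hg1' hw, hg2, (H g g' hg1 hg1' hw).trans ?_⟩
    rw [ENNReal.ofReal_mul ENNReal.toReal_nonneg, ENNReal.ofReal_toReal hC]
    gcongr
    calc _ ≤ ENNReal.ofReal R + ∑ i : Fin d, ENNReal.ofReal R :=
          add_le_add hg3 (Finset.sum_le_sum fun j _ => hg3' j)
      _ = _ := by
        rw [ENNReal.ofReal_mul (by positivity), ENNReal.ofReal_add zero_le_one (by positivity)]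
        simp [add_mul]

/-- The Sobolev embedding on the unit cube, uniformly on bounded sets. -/
theorem exists_eLpNorm_le_of_mem_sobolevBall {d : ℕ} (hd : 0 < d) (s : ℕ) {p r : ℝ} (hp : 1 < p)
    (hr : 1 < r) (hpr : 1 / p - (s : ℝ) / d ≤ 1 / r) (R : ℝ) :
    ∃ C : ℝ, ∀ f ∈ sobolevBall d s p R,
      eLpNorm f (ENNReal.ofReal r) (unif d) ≤ ENNReal.ofReal C := by
  induction s generalizing p R with
  | zero =>
    refine ⟨R, fun f hf => ?_⟩
    obtain ⟨g, hg1, hg2, hg3⟩ := hf.2 0 le_rfl Fin.elim0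
    rw [eLpNorm_congr_ae (hg2.ae_eq hp.le hf.1 hg1)]
    refine le_trans (eLpNorm_le_eLpNorm_of_exponent_le (ENNReal.ofReal_le_ofReal ?_) hg1.1) hg3
    simp only [Nat.cast_zero, zero_div, sub_zero] at hpr
    exact (one_div_le_one_div (by linarith) (by linarith)).1 hpr
  | succ s ih =>
    have hd0 : (0 : ℝ) < d := by exact_mod_cast hd
    have hip : 1 / p < 1 := by rw [div_lt_one (by linarith)]; exact hp
    have hir : 1 / r < 1 := by rw [div_lt_one (by linarith)]; exact hr
    have hir0 : 0 < 1 / r := by positivity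
    have hid0 : 0 < 1 / (d : ℝ) := by positivity
    -- One order is spent to reach the exponent 1/t. The maximum with 1/r keeps it finite even if
    -- 1/p ≤ 1/d.
    set t := max (1 / p - 1 / d) (1 / r) with ht
    have ht0 : 0 < t := lt_max_of_lt_right hir0
    have ht1 : t < 1 := max_lt (by linarith) hir
    have h1 : 1 < 1 / t := by rw [lt_div_iff₀ ht0]; linarith
    obtain ⟨R', hR'⟩ := exists_sobolevBall_succ_subset (s := s) hd hp h1
      (by rw [one_div_one_div]; exact le_max_left _ _) R
    obtain ⟨C, hC⟩ := ih h1 (by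
      rw [one_div_one_div, ht, sub_le_iff_le_add]
      refine max_le ?_ ?_
      · have : ((s + 1 : ℕ) : ℝ) / d = s / d + 1 / d := by push_cast; ring
        linarith
      · have : (0 : ℝ) ≤ s / d := by positivity
        linarith) R'
    exact ⟨C, fun f hf => hC f (hR' hf)⟩

/-- There are finitely many derivatives of order at most s, so the sum of their norms serves as R.
-/
theorem exists_mem_sobolevBall {d s : ℕ} {p : ℝ} {f : (Fin d → ℝ) → ℝ} (hf : f ∈ sobolev d s p) :
    ∃ R, f ∈ sobolevBall d s p R := by
  have h : ∀ (k : ℕ) (i : Fin k → Fin d), ∃ g : (Fin d → ℝ) → ℝ, k ≤ s →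
      MemLp g (ENNReal.ofReal p) (unif d) ∧ IsWeakDeriv i f g := by
    intro k i
    by_cases hk : k ≤ s
    · obtain ⟨g, hg⟩ := hf.2 k hk i
      exact ⟨g, fun _ => hg⟩
    · exact ⟨0, fun h => absurd h hk⟩
  choose g hg using h
  refine ⟨∑ k ∈ Finset.range (s + 1), ∑ i : Fin k → Fin d,
    (eLpNorm (g k i) (ENNReal.ofReal p) (unif d)).toReal, hf.1, fun k hk i => ?_⟩
  obtain ⟨h1, h2⟩ := hg k i hk
  refine ⟨g k i, h1, h2, ?_⟩
  rw [← ENNReal.ofReal_toReal h1.2.ne]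
  refine ENNReal.ofReal_le_ofReal ?_
  refine le_trans ?_ (Finset.single_le_sum
    (f := fun k => ∑ i : Fin k → Fin d, (eLpNorm (g k i) (ENNReal.ofReal p) (unif d)).toReal)
    (fun k _ => Finset.sum_nonneg fun i _ => ENNReal.toReal_nonneg)
    (Finset.mem_range.2 (Nat.lt_succ_of_le hk)))
  exact Finset.single_le_sum
    (f := fun i : Fin k → Fin d => (eLpNorm (g k i) (ENNReal.ofReal p) (unif d)).toReal)
    (fun i _ => ENNReal.toReal_nonneg) (Finset.mem_univ i)

end ControlVariate

/-! ### Monte Carlo averages and sample splitting -/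

/-- The mean absolute error of the Monte Carlo estimate of an integral. -/
theorem lintegral_enorm_average_sub_integral_le {β : Type*} [MeasurableSpace β] (μ : Measure β)
    [IsProbabilityMeasure μ] {m : ℕ} (hm : 0 < m) {h : β → ℝ} (hh : MemLp h 2 μ) :
    ∫⁻ y, ‖1 / (m : ℝ) * ∑ i, h (y i) - ∫ z, h z ∂μ‖ₑ ∂Measure.pi (fun _ : Fin m => μ) ≤
      ENNReal.ofReal ((m : ℝ) ^ (-(1 / 2) : ℝ)) * eLpNorm h 2 μ := by
  have hm0 : (0 : ℝ) < m := by exact_mod_cast hm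
  set P := Measure.pi (fun _ : Fin m => μ) with hP
  set X : Fin m → (Fin m → β) → ℝ := fun i y => h (y i) with hX
  have hXL : ∀ i, MemLp (X i) 2 P := fun i =>
    hh.comp_measurePreserving (measurePreserving_eval _ i)
  set Y : (Fin m → β) → ℝ := fun y => 1 / (m : ℝ) * (∑ i, X i) y with hY
  have hYL : MemLp Y 2 P := (memLp_finsetSum' _ fun i _ => hXL i).const_mul _
  have hmean : ∫ y, Y y ∂P = ∫ z, h z ∂μ := by
    rw [hY, integral_const_mul]
    simp only [Finset.sum_apply]
    rw [integral_finsetSum _ fun i _ => (hXL i).integrable (by norm_num)]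
    have : ∀ i, ∫ y, X i y ∂P = ∫ z, h z ∂μ := fun i =>
      integral_comp_eval (μ := fun _ : Fin m => μ) hh.1
    simp only [this, Finset.sum_const, Finset.card_univ, Fintype.card_fin, nsmul_eq_mul]
    field_simp
  -- Independence makes the variance of the average 1/m times that of h, which is at most the second
  -- moment.
  have hvar : ProbabilityTheory.variance Y P ≤ 1 / m * ∫ z, h z ^ 2 ∂μ := by
    rw [hY, ProbabilityTheory.variance_const_mul]
    have h1 := ProbabilityTheory.variance_sum_pi (μ := fun _ : Fin m => μ) (X := fun _ => h)
      fun _ => hh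
    have h2 := ProbabilityTheory.variance_le_expectation_sq hh.1
    simp only [Finset.sum_const, Finset.card_univ, Fintype.card_fin, nsmul_eq_mul] at h1
    have h3 : ProbabilityTheory.variance (fun y => (∑ i, X i) y) P =
      m * ProbabilityTheory.variance h μ := h1
    rw [h3]
    calc (1 / (m : ℝ)) ^ 2 * (m * ProbabilityTheory.variance h μ)
        = 1 / m * ProbabilityTheory.variance h μ := by field_simp
      _ ≤ _ := by gcongr; exact h2
  have hsq : ENNReal.ofReal (∫ z, h z ^ 2 ∂μ) = eLpNorm h 2 μ ^ (2 : ℝ) := by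
    rw [ofReal_integral_eq_lintegral_ofReal hh.integrable_sq
      (Filter.Eventually.of_forall fun z => sq_nonneg _),
      eLpNorm_eq_lintegral_rpow_enorm_toReal (by norm_num) (by norm_num), ← ENNReal.rpow_mul]
    simp only [ENNReal.toReal_ofNat, one_div, inv_mul_cancel₀ (two_ne_zero' ℝ), ENNReal.rpow_one]
    refine lintegral_congr fun z => ?_
    rw [← sq_abs, ENNReal.ofReal_pow (abs_nonneg _), ← Real.enorm_eq_ofReal_abs]
    norm_cast
  calc ∫⁻ y, ‖1 / (m : ℝ) * ∑ i, h (y i) - ∫ z, h z ∂μ‖ₑ ∂P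
      = ∫⁻ y, ‖Y y - ∫ y, Y y ∂P‖ₑ ∂P := by
        rw [hmean]; simp [hY, hX]
    _ ≤ (∫⁻ y, ‖Y y - ∫ y, Y y ∂P‖ₑ ^ (2 : ℝ) ∂P) ^ (1 / 2 : ℝ) :=
        ENNReal.lintegral_le_rpow_lintegral_rpow P (by norm_num)
          (hYL.1.sub aestronglyMeasurable_const).enorm
    _ = ENNReal.ofReal (ProbabilityTheory.variance Y P) ^ (1 / 2 : ℝ) := by
        rw [hYL.ofReal_variance_eq, ProbabilityTheory.evariance]
        norm_cast
    _ ≤ ENNReal.ofReal (1 / m * ∫ z, h z ^ 2 ∂μ) ^ (1 / 2 : ℝ) := by gcongr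
    _ = _ := by
        rw [ENNReal.ofReal_mul (by positivity), hsq, ENNReal.mul_rpow_of_nonneg _ _ (by norm_num),
          ← ENNReal.rpow_mul, ENNReal.ofReal_rpow_of_pos (by positivity)]
        norm_num
        rw [Real.rpow_neg hm0.le, Real.inv_rpow hm0.le]

/-- A Monte Carlo estimate whose integrand depends on an independent variable. -/
theorem lintegral_enorm_average_sub_integral_prod_le {α β : Type*} [MeasurableSpace α]
    [MeasurableSpace β] (ν : Measure α) [IsProbabilityMeasure ν] (μ : Measure β)
    [IsProbabilityMeasure μ] {m : ℕ} (hm : 0 < m) {H : α × β → ℝ}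
    (hH : AEStronglyMeasurable H (ν.prod μ)) (hH2 : ∀ᵐ x ∂ν, MemLp (fun z => H (x, z)) 2 μ) :
    AEStronglyMeasurable (fun w : α × (Fin m → β) =>
        1 / (m : ℝ) * ∑ i, H (w.1, w.2 i) - ∫ z, H (w.1, z) ∂μ)
        (ν.prod (Measure.pi fun _ => μ)) ∧
      ∫⁻ w : α × (Fin m → β), ‖1 / (m : ℝ) * ∑ i, H (w.1, w.2 i) - ∫ z, H (w.1, z) ∂μ‖ₑ
        ∂(ν.prod (Measure.pi fun _ => μ)) ≤
      ENNReal.ofReal ((m : ℝ) ^ (-(1 / 2) : ℝ)) * ∫⁻ x, eLpNorm (fun z => H (x, z)) 2 μ ∂ν := by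
  have hmeas : AEStronglyMeasurable (fun w : α × (Fin m → β) =>
        1 / (m : ℝ) * ∑ i, H (w.1, w.2 i) - ∫ z, H (w.1, z) ∂μ)
        (ν.prod (Measure.pi fun _ => μ)) := by
    refine AEStronglyMeasurable.sub (AEStronglyMeasurable.const_mul ?_ _)
      (hH.integral_prod_right'.comp_fst)
    refine Finset.aestronglyMeasurable_fun_sum _ fun i _ => ?_
    exact hH.comp_measurePreserving
      ((MeasurePreserving.id ν).prod (measurePreserving_eval (fun _ : Fin m => μ) i))
  refine ⟨hmeas, ?_⟩
  rw [lintegral_prod _ hmeas.enorm, ← lintegral_const_mul' _ _ ENNReal.ofReal_ne_top]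
  refine lintegral_mono_ae ?_
  filter_upwards [hH2] with x hx
  exact lintegral_enorm_average_sub_integral_le μ hm hx

/-- Splitting a sequence of independent points into its first and its last part. -/
theorem measurePreserving_castAdd_natAdd {β : Type*} [MeasurableSpace β] (μ : Measure β)
    [IsProbabilityMeasure μ] (m n : ℕ) :
    MeasurePreserving (fun x : Fin (m + n) → β =>
        (fun i => x (Fin.castAdd n i), fun i => x (Fin.natAdd m i)))
      (Measure.pi fun _ => μ) ((Measure.pi fun _ : Fin m => μ).prod (Measure.pi fun _ => μ)) := by
  have hs : Measurable (fun x : Fin (m + n) → β =>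
        ((fun i => x (Fin.castAdd n i) : Fin m → β), (fun i => x (Fin.natAdd m i) : Fin n → β))) := by
    fun_prop
  have ha : Measurable (fun w : (Fin m → β) × (Fin n → β) => Fin.append w.1 w.2) := by
    refine measurable_pi_iff.2 fun i => ?_
    refine Fin.addCases (fun i => ?_) (fun i => ?_) i
    · simp only [Fin.append_left]
      fun_prop
    · simp only [Fin.append_right]
      fun_prop
  refine ⟨hs, ?_⟩
  -- A product measure is determined on boxes, so the inverse map `Fin.append` is the convenient one
  -- to check.
  have key : (Measure.pi fun _ : Fin (m + n) => μ) =
      ((Measure.pi fun _ : Fin m => μ).prod (Measure.pi fun _ : Fin n => μ)).map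
        (fun w => Fin.append w.1 w.2) := by
    refine Measure.pi_eq fun s hsm => ?_
    rw [Measure.map_apply ha (MeasurableSet.univ_pi hsm)]
    have : (fun w : (Fin m → β) × (Fin n → β) => Fin.append w.1 w.2) ⁻¹' Set.univ.pi s =
        (Set.univ.pi fun i => s (Fin.castAdd n i)) ×ˢ (Set.univ.pi fun i => s (Fin.natAdd m i)) := by
      ext w
      simp only [Set.mem_preimage, Set.mem_pi, Set.mem_univ, forall_true_left, Set.mem_prod]
      constructor
      · intro h
        exact ⟨fun i => by simpa using h (Fin.castAdd n i),
          fun i => by simpa using h (Fin.natAdd m i)⟩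
      · rintro ⟨h1, h2⟩ i
        refine Fin.addCases (fun i => ?_) (fun i => ?_) i
        · simpa using h1 i
        · simpa using h2 i
    rw [this, Measure.prod_prod, Measure.pi_pi, Measure.pi_pi, Fin.prod_univ_add]
  rw [key, Measure.map_map hs ha]
  convert! Measure.map_id using 2
  ext w <;> simp

/-! ### Differences of q-th powers -/

/-- A pointwise bound for the difference of `q`-th powers. -/
theorem abs_pow_sub_pow_le_mul_add (x y : ℝ) {q : ℕ} (hq : 0 < q) :
    |x ^ q - y ^ q| ≤ q * 2 ^ q * (|y - x| * |x| ^ (q - 1) + |y - x| ^ q) := by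
  have h1 := abs_pow_sub_pow_le x y q
  -- y is replaced by x and y - x: the oracle's output must enter only through its error, as it has
  -- no norm bound of its own.
  have h2 : max |x| |y| ≤ |x| + |y - x| := by
    refine max_le (by linarith [abs_nonneg (y - x)]) ?_
    calc |y| = |x + (y - x)| := by congr 1; ring
      _ ≤ _ := abs_add_le _ _
  have h3 : max |x| |y| ^ (q - 1) ≤ 2 ^ q * (|x| ^ (q - 1) + |y - x| ^ (q - 1)) := by
    calc max |x| |y| ^ (q - 1) ≤ (|x| + |y - x|) ^ (q - 1) :=
          pow_le_pow_left₀ (le_max_of_le_left (abs_nonneg _)) h2 _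
      _ ≤ 2 ^ (q - 1 - 1) * (|x| ^ (q - 1) + |y - x| ^ (q - 1)) :=
          add_pow_le (abs_nonneg _) (abs_nonneg _) _
      _ ≤ _ := by
          gcongr
          · norm_num
          · omega
  calc |x ^ q - y ^ q| ≤ |x - y| * q * max |x| |y| ^ (q - 1) := h1
    _ ≤ |x - y| * q * (2 ^ q * (|x| ^ (q - 1) + |y - x| ^ (q - 1))) := by gcongr
    _ = q * 2 ^ q * (|y - x| * |x| ^ (q - 1) + |y - x| * |y - x| ^ (q - 1)) := by
        rw [abs_sub_comm x y]; ring
    _ = _ := by rw [← pow_succ', Nat.sub_add_cancel hq]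

theorem MeasureTheory.eLpNorm_abs_pow {α : Type*} [MeasurableSpace α] {μ : Measure α} (f : α → ℝ)
    {k : ℕ} (hk : 0 < k) (t : ℝ) (ht : 0 ≤ t) :
    eLpNorm (fun x => |f x| ^ k) (ENNReal.ofReal t) μ =
      eLpNorm f (ENNReal.ofReal (t * k)) μ ^ k := by
  have h := eLpNorm_norm_rpow (p := ENNReal.ofReal t) (μ := μ) f (q := k) (by exact_mod_cast hk)
  simpa only [Real.rpow_natCast, ENNReal.rpow_natCast, Real.norm_eq_abs,
    ← ENNReal.ofReal_mul ht] using h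

theorem MeasureTheory.MemLp.pow_nat {α : Type*} [MeasurableSpace α] {μ : Measure α} {f : α → ℝ}
    {k : ℕ} (hk : 0 < k) {t : ℝ} (ht : 0 ≤ t) (hf : MemLp f (ENNReal.ofReal (t * k)) μ) :
    MemLp (fun x => f x ^ k) (ENNReal.ofReal t) μ := by
  refine ⟨hf.1.pow k, ?_⟩
  rw [← eLpNorm_norm]
  simp only [norm_pow, Real.norm_eq_abs]
  rw [eLpNorm_abs_pow f hk t ht]
  exact ENNReal.pow_lt_top hf.2

/-- The `L²` distance of `q`-th powers in terms of norms of the difference. -/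
theorem eLpNorm_pow_sub_pow_le {α : Type*} [MeasurableSpace α] {μ : Measure α} {f g : α → ℝ}
    (hf : AEStronglyMeasurable f μ) (hg : AEStronglyMeasurable g μ) {q : ℕ} (hq : 2 ≤ q)
    {a b : ℝ} (ha : 0 < a) (hb : 0 < b) (hab : 1 / a + 1 / b = 1 / 2) :
    eLpNorm (fun x => f x ^ q - g x ^ q) 2 μ ≤ ENNReal.ofReal (q * 2 ^ q) *
      (eLpNorm (fun x => g x - f x) (ENNReal.ofReal a) μ *
          eLpNorm f (ENNReal.ofReal (b * (q - 1 : ℕ))) μ ^ (q - 1) +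
        eLpNorm (fun x => g x - f x) (ENNReal.ofReal (2 * q)) μ ^ q) := by
  have he : AEStronglyMeasurable (fun x => g x - f x) μ := hg.sub hf
  have hht : ENNReal.HolderTriple (ENNReal.ofReal a) (ENNReal.ofReal b) 2 := by
    constructor
    rw [← ENNReal.ofReal_inv_of_pos ha, ← ENNReal.ofReal_inv_of_pos hb,
      ← ENNReal.ofReal_add (by positivity) (by positivity)]
    simp only [one_div] at hab
    rw [hab, ENNReal.ofReal_inv_of_pos two_pos, ENNReal.ofReal_ofNat]
  have h1 : eLpNorm (fun x => |g x - f x| * |f x| ^ (q - 1)) 2 μ ≤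
      eLpNorm (fun x => g x - f x) (ENNReal.ofReal a) μ *
          eLpNorm f (ENNReal.ofReal (b * (q - 1 : ℕ))) μ ^ (q - 1) := by
    have h := eLpNorm_smul_le_mul_eLpNorm (p := ENNReal.ofReal a) (q := ENNReal.ofReal b) (r := 2)
      (μ := μ) (f := fun x => |f x| ^ (q - 1)) (φ := fun x => |g x - f x|)
      (hf.norm.pow _) he.norm
    rw [eLpNorm_abs_pow f (by omega) b hb.le] at h
    have h' := eLpNorm_norm (p := ENNReal.ofReal a) (μ := μ) (fun x => g x - f x)
    simp only [Real.norm_eq_abs] at h'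
    rw [h'] at h
    exact h
  have h2 : eLpNorm (fun x => |g x - f x| ^ q) 2 μ =
      eLpNorm (fun x => g x - f x) (ENNReal.ofReal (2 * q)) μ ^ q := by
    have := eLpNorm_abs_pow (μ := μ) (fun x => g x - f x) (k := q) (by omega) 2 (by norm_num)
    rwa [ENNReal.ofReal_ofNat] at this
  calc eLpNorm (fun x => f x ^ q - g x ^ q) 2 μ
      ≤ eLpNorm (((q : ℝ) * 2 ^ q) • ((fun x => |g x - f x| * |f x| ^ (q - 1)) +
          fun x => |g x - f x| ^ q)) 2 μ := by
        refine eLpNorm_mono_real fun x => ?_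
        simpa using abs_pow_sub_pow_le_mul_add (f x) (g x) (q := q) (by omega)
    _ = ENNReal.ofReal (q * 2 ^ q) * eLpNorm ((fun x => |g x - f x| * |f x| ^ (q - 1)) +
          fun x => |g x - f x| ^ q) 2 μ := by
        rw [eLpNorm_const_smul, Real.enorm_of_nonneg (by positivity)]
    _ ≤ _ := by
        gcongr
        refine (eLpNorm_add_le (he.norm.mul (hf.norm.pow _)) (he.norm.pow _) (by norm_num)).trans ?_
        exact add_le_add h1 h2.le

/-! ### The error of the control variate estimator -/

namespace ControlVariate

instance (d n : ℕ) : IsProbabilityMeasure (sampleLaw d n) := by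
  rw [sampleLaw]; infer_instance

theorem sobolevBall_subset_sobolev (d s : ℕ) (p R : ℝ) : sobolevBall d s p R ⊆ sobolev d s p :=
  fun _ hf => ⟨hf.1, fun k hk i => let ⟨g, h1, h2, _⟩ := hf.2 k hk i; ⟨g, h1, h2⟩⟩

/-- Used also for the oracle's output, for which only finiteness of the norm matters. -/
theorem memLp_of_mem_sobolev {d s : ℕ} (hd : 0 < d) {p r : ℝ} (hp : 1 < p) (hr : 1 < r)
    (hpr : 1 / p - (s : ℝ) / d ≤ 1 / r) {f : (Fin d → ℝ) → ℝ} (hf : f ∈ sobolev d s p) :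
    MemLp f (ENNReal.ofReal r) (unif d) := by
  obtain ⟨R, hR⟩ := exists_mem_sobolevBall hf
  obtain ⟨C, hC⟩ := exists_eLpNorm_le_of_mem_sobolevBall hd s hp hr hpr R
  exact ⟨hf.1.1, (hC f hR).trans_lt ENNReal.ofReal_lt_top⟩

theorem ae_sampleLaw_mem_cube (d n : ℕ) : ∀ᵐ x ∂sampleLaw d n, ∀ i, x i ∈ cube d := by
  refine ae_all_iff.2 fun i => ?_
  exact (measurePreserving_eval (fun _ : Fin n => unif d) i).quasiMeasurePreserving.ae
    (ae_restrict_mem (measurableSet_cube d))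

/-- Hölder exponents for which `‖(f - g) f^(q-1)‖₂` is controlled at the optimal rate. -/
theorem exists_holder_exponents {q : ℕ} {p σ : ℝ} (hp : 2 < p) (hq : 2 ≤ q) (hσ : 0 < σ)
    (hT : 1 / p - σ < 1 / (2 * q)) :
    ∃ a b : ℝ, 1 ≤ a ∧ 2 < b ∧ 1 / a + 1 / b = 1 / 2 ∧ 1 / p - σ < 1 / a ∧
      1 / p - σ ≤ 1 / (b * (q - 1 : ℕ)) ∧
      -σ + max (1 / p - 1 / a) 0 = max (-(q : ℝ) * (σ - 1 / p) - 1 / 2) (-σ) := by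
  have hq2 : (2 : ℝ) ≤ q := by exact_mod_cast hq
  have hq1 : ((q - 1 : ℕ) : ℝ) = q - 1 := by rw [Nat.cast_sub (by omega)]; simp
  have hip : 1 / p < 1 / 2 := one_div_lt_one_div_of_lt two_pos hp
  have hip0 : 0 < 1 / p := by positivity
  set T := 1 / p - σ with hTdef
  have hqT : q * T < 1 / 2 := by
    rw [lt_div_iff₀ (by positivity)] at hT
    linarith
  -- t = 1/a. The first entry is where the oracle rate stops improving; the second is the largest t
  -- for which f still embeds in L^{b(q-1)}, with equality at the critical exponent. T < t follows
  -- from qT < 1/2.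
  set t := min (1 / p) (1 / 2 - (q - 1) * T) with ht
  have hTt : T < t := lt_min (by linarith) (by linarith)
  have ht0 : 0 < t := by
    refine lt_min hip0 ?_
    rcases le_or_gt T 0 with h | h
    · have : (q - 1) * T ≤ 0 := mul_nonpos_of_nonneg_of_nonpos (by linarith) h
      linarith
    · linarith
  have htp : t ≤ 1 / p := min_le_left _ _
  have ht2 : 0 < 1 / 2 - t := by linarith
  refine ⟨1 / t, 1 / (1 / 2 - t), ?_, ?_, ?_, ?_, ?_, ?_⟩
  · rw [le_div_iff₀ ht0]; linarith
  · rw [lt_div_iff₀ ht2]; linarith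
  · simp
  · simpa using hTt
  · rw [hq1, div_mul_eq_mul_div, one_mul, one_div_div, le_div_iff₀ (by linarith)]
    have : t ≤ 1 / 2 - (q - 1) * T := min_le_right _ _
    linarith
  · rw [one_div_one_div, max_eq_left (by linarith), ht]
    rcases le_total (1 / p) (1 / 2 - (q - 1) * T) with h | h
    · rw [min_eq_left h, max_eq_right]
      · ring
      · rw [hTdef] at h; linarith
    · rw [min_eq_right h, max_eq_left]
      · rw [hTdef]; ring
      · rw [hTdef] at h; linarith

theorem aemeasurable_eLpNorm_prod {α β : Type*} [MeasurableSpace α] [MeasurableSpace β]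
    {ν : Measure α} {μ : Measure β} [SFinite μ] {H : α × β → ℝ} (hH : AEMeasurable H (ν.prod μ))
    {r : ℝ} (hr : 0 < r) : AEMeasurable (fun x => eLpNorm (fun z => H (x, z)) (ENNReal.ofReal r) μ) ν := by
  simp only [eLpNorm_eq_lintegral_rpow_enorm_toReal (p := ENNReal.ofReal r) (by simpa using hr)
    (by simp), ENNReal.toReal_ofReal hr.le]
  exact ((hH.enorm.pow_const r).lintegral_prod_right').pow_const _

/-- The mean `L²` distance of the `q`-th powers of `f` and of its reconstruction. -/
theorem lintegral_eLpNorm_pow_sub_pow_le {d s q m : ℕ} {p : ℝ} {K : Oracle d}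
    (hK : IsFunctionEstimator d s p K) (hm : 0 < m) (hq : 2 ≤ q) {f : (Fin d → ℝ) → ℝ}
    (hf : f ∈ sobolev d s p) {a b : ℝ} (ha : 1 ≤ a) (hb : 0 < b) (hab : 1 / a + 1 / b = 1 / 2)
    {A B M : ℝ≥0∞}
    (hA : (∫⁻ x, eLpNorm (fun z => K m x (f ∘ x) z - f z) (ENNReal.ofReal a) (unif d) ^ a
      ∂(sampleLaw d m)) ^ (1 / a) ≤ A)
    (hB : (∫⁻ x, eLpNorm (fun z => K m x (f ∘ x) z - f z) (ENNReal.ofReal (2 * q)) (unif d) ^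
      (2 * q : ℝ) ∂(sampleLaw d m)) ^ (1 / (2 * q : ℝ)) ≤ B)
    (hM : eLpNorm f (ENNReal.ofReal (b * (q - 1 : ℕ))) (unif d) ≤ M) :
    ∫⁻ x, eLpNorm (fun z => f z ^ q - K m x (f ∘ x) z ^ q) 2 (unif d) ∂(sampleLaw d m) ≤
      ENNReal.ofReal (q * 2 ^ q) * (A * M ^ (q - 1) + B ^ q) := by
  have hq0 : (0 : ℝ) < q := by exact_mod_cast (by omega : 0 < q)
  have hE : AEMeasurable (fun z : (Fin m → Fin d → ℝ) × (Fin d → ℝ) => K m z.1 (f ∘ z.1) z.2 - f z.2)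
      ((sampleLaw d m).prod (unif d)) :=
    (hK.aemeasurable m hm f hf).sub hf.1.1.aemeasurable.comp_snd
  set e : (Fin m → Fin d → ℝ) → ℝ → ℝ≥0∞ := fun x r =>
    eLpNorm (fun z => K m x (f ∘ x) z - f z) (ENNReal.ofReal r) (unif d) with he
  have hem : ∀ r, 0 < r → AEMeasurable (fun x => e x r) (sampleLaw d m) := fun r hr =>
    aemeasurable_eLpNorm_prod hE hr
  have h1 : ∫⁻ x, e x a ∂sampleLaw d m ≤ A :=
    (ENNReal.lintegral_le_rpow_lintegral_rpow _ ha (hem a (by linarith))).trans hA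
  -- Jensen with exponent 2 turns the q-th moment into the 2q-th moment that the oracle rate at r =
  -- 2q controls.
  have h2 : ∫⁻ x, e x (2 * q) ^ q ∂sampleLaw d m ≤ B ^ q := by
    calc ∫⁻ x, e x (2 * q) ^ q ∂sampleLaw d m
        ≤ (∫⁻ x, (e x (2 * q) ^ q) ^ (2 : ℝ) ∂sampleLaw d m) ^ (1 / 2 : ℝ) :=
          ENNReal.lintegral_le_rpow_lintegral_rpow _ one_le_two
            ((hem (2 * q) (by positivity)).pow_const q)
      _ = ((∫⁻ x, e x (2 * q) ^ (2 * q : ℝ) ∂sampleLaw d m) ^ (1 / (2 * q : ℝ))) ^ q := by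
          rw [← ENNReal.rpow_natCast _ q, ← ENNReal.rpow_mul]
          congr 1
          · refine lintegral_congr fun x => ?_
            rw [← ENNReal.rpow_natCast _ q, ← ENNReal.rpow_mul, mul_comm]
          · field_simp
      _ ≤ B ^ q := by gcongr
  calc ∫⁻ x, eLpNorm (fun z => f z ^ q - K m x (f ∘ x) z ^ q) 2 (unif d) ∂(sampleLaw d m)
      ≤ ∫⁻ x, ENNReal.ofReal (q * 2 ^ q) * (e x a * M ^ (q - 1) + e x (2 * q) ^ q)
          ∂(sampleLaw d m) := by
        refine lintegral_mono_ae ?_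
        filter_upwards [ae_sampleLaw_mem_cube d m] with x hx
        refine (eLpNorm_pow_sub_pow_le hf.1.1 (hK.mem_sobolev m hm x hx (f ∘ x)).1.1 hq
          (by linarith) hb hab).trans ?_
        simp only [he]
        gcongr
    _ = ENNReal.ofReal (q * 2 ^ q) * ((∫⁻ x, e x a ∂sampleLaw d m) * M ^ (q - 1) +
          ∫⁻ x, e x (2 * q) ^ q ∂sampleLaw d m) := by
        rw [lintegral_const_mul' _ _ ENNReal.ofReal_ne_top,
          lintegral_add_left' ((hem a (by linarith)).mul_const _),
          lintegral_mul_const'' _ (hem a (by linarith))]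
    _ ≤ _ := by gcongr

/-- The mean absolute error of the control variate estimator is bounded by the mean `L²` distance of
the `q`-th powers. -/
theorem integrable_and_lintegral_estimator_sub_moment_le {d s q m : ℕ} {p : ℝ} {K : Oracle d}
    (hK : IsFunctionEstimator d s p K) (hd : 0 < d) (hp : 2 < p) (hm : 0 < m) (hq : 2 ≤ q)
    (hs : 1 / p - (s : ℝ) / d ≤ 1 / (2 * q)) {f : (Fin d → ℝ) → ℝ} (hf : f ∈ sobolev d s p) :
    AEStronglyMeasurable (fun x => estimator K q m x (f ∘ x) - moment q f)
        (sampleLaw d (m + m)) ∧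
      ∫⁻ x, ‖estimator K q m x (f ∘ x) - moment q f‖ₑ ∂(sampleLaw d (m + m)) ≤
        ENNReal.ofReal ((m : ℝ) ^ (-(1 / 2) : ℝ)) *
          ∫⁻ x, eLpNorm (fun z => f z ^ q - K m x (f ∘ x) z ^ q) 2 (unif d) ∂(sampleLaw d m) := by
  have hq2 : (2 : ℝ) ≤ q := by exact_mod_cast hq
  have hm0 : (0 : ℝ) < m := by exact_mod_cast hm
  have hpow : ∀ g ∈ sobolev d s p, MemLp (fun z => g z ^ q) 2 (unif d) := fun g hg => by
    have := (memLp_of_mem_sobolev (r := 2 * q) hd (by linarith) (by linarith) hs hg).pow_nat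
      (by omega : 0 < q) zero_le_two
    rwa [ENNReal.ofReal_ofNat] at this
  set H : (Fin m → Fin d → ℝ) × (Fin d → ℝ) → ℝ := fun w =>
    f w.2 ^ q - K m w.1 (f ∘ w.1) w.2 ^ q with hH
  have hHm : AEStronglyMeasurable H ((sampleLaw d m).prod (unif d)) :=
    ((hf.1.1.aemeasurable.comp_snd.pow_const q).sub
      ((hK.aemeasurable m hm f hf).pow_const q)).aestronglyMeasurable
  have hH2 : ∀ᵐ x ∂sampleLaw d m, MemLp (fun z => H (x, z)) 2 (unif d) := by
    filter_upwards [ae_sampleLaw_mem_cube d m] with x hx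
    exact (hpow f hf).sub (hpow _ (hK.mem_sobolev m hm x hx (f ∘ x)))
  obtain ⟨h1, h2⟩ := lintegral_enorm_average_sub_integral_prod_le (sampleLaw d m) (unif d) hm hHm hH2
  have hσ := measurePreserving_castAdd_natAdd (unif d) m m
  set τ : (Fin (m + m) → Fin d → ℝ) → (Fin m → Fin d → ℝ) × (Fin m → Fin d → ℝ) := fun x =>
    (fun i => x (Fin.castAdd m i), fun i => x (Fin.natAdd m i)) with hτ
  set I : (Fin m → Fin d → ℝ) × (Fin m → Fin d → ℝ) → ℝ := fun w =>
    1 / (m : ℝ) * ∑ i, H (w.1, w.2 i) - ∫ z, H (w.1, z) ∂unif d with hI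
  have hcube : ∀ᵐ x ∂sampleLaw d (m + m), ∀ i, (τ x).1 i ∈ cube d := by
    filter_upwards [ae_sampleLaw_mem_cube d (m + m)] with x hx i
    exact hx _
  -- The integral of g^q in the estimator cancels the one in the mean of H, leaving a centred
  -- average. Only almost every sample qualifies, since the oracle's output is known to be Sobolev
  -- only for points in the cube.
  have hae : (fun x => estimator K q m x (f ∘ x) - moment q f) =ᵐ[sampleLaw d (m + m)] I ∘ τ := by
    filter_upwards [hcube] with x hx
    have hg := hpow _ (hK.mem_sobolev m hm (τ x).1 hx (f ∘ (τ x).1))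
    have hint : ∫ z, H ((τ x).1, z) ∂unif d = moment q f -
        ∫ z, K m (τ x).1 (f ∘ (τ x).1) z ^ q ∂unif d :=
      integral_sub ((hpow f hf).integrable one_le_two) (hg.integrable one_le_two)
    have hcoef : 2 / ((m + m : ℕ) : ℝ) = 1 / m := by
      push_cast; field_simp; norm_num
    simp only [hI, Function.comp_apply]
    rw [hint, estimator, hcoef]
    have e1 : (∫ z in cube d, K m (fun i => x (Fin.castAdd m i))
        (fun i => (f ∘ x) (Fin.castAdd m i)) z ^ q) =
        ∫ z, K m (τ x).1 (f ∘ (τ x).1) z ^ q ∂unif d := rfl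
    have e2 : ∑ i : Fin m, ((f ∘ x) (Fin.natAdd m i) ^ q - K m (fun i => x (Fin.castAdd m i))
        (fun i => (f ∘ x) (Fin.castAdd m i)) (x (Fin.natAdd m i)) ^ q) =
        ∑ i, H ((τ x).1, (τ x).2 i) := rfl
    simp only [e1, e2]
    ring
  refine ⟨(h1.comp_measurePreserving hσ).congr hae.symm, ?_⟩
  calc ∫⁻ x, ‖estimator K q m x (f ∘ x) - moment q f‖ₑ ∂(sampleLaw d (m + m))
      = ∫⁻ x, ‖I (τ x)‖ₑ ∂(sampleLaw d (m + m)) :=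
        lintegral_congr_ae (hae.fun_comp fun t => ‖t‖ₑ)
    _ = ∫⁻ w, ‖I w‖ₑ ∂((sampleLaw d m).prod (sampleLaw d m)) := by
        have h3 := hσ.map_eq
        rw [sampleLaw, sampleLaw, ← h3, lintegral_map' _ hσ.measurable.aemeasurable]
        rw [h3]
        exact h1.enorm
    _ ≤ _ := h2

/-- Error bounds that are uniform over a bounded subset of the Sobolev space. -/
theorem exists_errorBound_of_subset_sobolevBall {d s q : ℕ} {p : ℝ} (hd : 0 < d) (hp : 2 < p)
    (hpq : p < 2 * q) (hs : (d : ℝ) * (2 * q - p) / (2 * p * q) < s) {K : Oracle d}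
    (hK : IsFunctionEstimator d s p K) {R : ℝ} {F : Set ((Fin d → ℝ) → ℝ)}
    (hF : F ⊆ sobolevBall d s p R) (hrate : HasOracleRate d s p K F) :
    ∃ C : ℝ, ∀ f ∈ F, ErrorBound d s q p K f C := by
  have hd0 : (0 : ℝ) < d := by exact_mod_cast hd
  have hq : 2 ≤ q := by
    have : (1 : ℝ) < q := by linarith
    exact_mod_cast this
  have hq2 : (2 : ℝ) ≤ q := by exact_mod_cast hq
  have hp0 : 0 < p := by linarith
  set σ : ℝ := (s : ℝ) / d with hσ
  -- The assumption on s, rewritten: r = 2q is an admissible oracle exponent, and W^{s,p} embeds in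
  -- L^{2q}.
  have hσT : 1 / p - σ < 1 / (2 * q) := by
    have h1 : (2 * q - p) / (2 * p * q) < σ := by
      rw [hσ, lt_div_iff₀ hd0]
      calc _ = (d : ℝ) * (2 * q - p) / (2 * p * q) := by ring
        _ < s := hs
    have h2 : (2 * q - p) / (2 * p * q) = 1 / p - 1 / (2 * q) := by field_simp
    linarith
  have hσ0 : 0 < σ := by
    have : 1 / (2 * (q : ℝ)) < 1 / p := one_div_lt_one_div_of_lt hp0 hpq
    linarith
  have hoc : (d - s * p) / (p * d) = 1 / p - σ := by rw [hσ]; field_simp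
  obtain ⟨a, b, ha, hb, hab, haT, hbT, hexp⟩ := exists_holder_exponents hp hq hσ0 hσT
  obtain ⟨Ca, hCa⟩ := hrate a ha (by rw [hoc]; exact haT)
  obtain ⟨Cq, hCq⟩ := hrate (2 * q) (by linarith) (by rw [hoc]; exact hσT)
  have hq1 : (1 : ℝ) ≤ ((q - 1 : ℕ) : ℝ) := by exact_mod_cast (by omega : 1 ≤ q - 1)
  obtain ⟨M, hM⟩ := exists_eLpNorm_le_of_mem_sobolevBall hd s (p := p) (r := b * (q - 1 : ℕ))
    (by linarith) (by nlinarith) hbT R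
  set E : ℝ := max (-(q : ℝ) * ((s : ℝ) / d - 1 / p) - 1) (-(s : ℝ) / d - 1 / 2) with hE
  set D : ℝ := q * 2 ^ q * (|Ca| * |M| ^ (q - 1) + |Cq| ^ q) with hD
  have hD0 : 0 ≤ D := by positivity
  -- The factor 2^(-E) passes from the half size m to the full size m + m.
  refine ⟨D * (2 : ℝ) ^ (-E), fun f hf m hm => ?_⟩
  have hm0 : (0 : ℝ) < m := by exact_mod_cast hm
  have hm1 : (1 : ℝ) ≤ m := by exact_mod_cast hm
  have hfs := sobolevBall_subset_sobolev d s p R (hF hf)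
  obtain ⟨hmeas, hle⟩ := integrable_and_lintegral_estimator_sub_moment_le hK hd hp hm hq hσT.le hfs
  set e₁ : ℝ := -(s : ℝ) / d + max (1 / p - 1 / a) 0 with he₁
  set e₂ : ℝ := -(s : ℝ) / d + max (1 / p - 1 / (2 * q)) 0 with he₂
  have hA := (hCa f hf m hm).trans (ENNReal.ofReal_le_ofReal
    (mul_le_mul_of_nonneg_right (le_abs_self Ca) (Real.rpow_nonneg hm0.le e₁)))
  have hB := (hCq f hf m hm).trans (ENNReal.ofReal_le_ofReal
    (mul_le_mul_of_nonneg_right (le_abs_self Cq) (Real.rpow_nonneg hm0.le e₂)))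
  have hMf := (hM f (hF hf)).trans (ENNReal.ofReal_le_ofReal (le_abs_self M))
  have hmean := lintegral_eLpNorm_pow_sub_pow_le hK hm hq hfs ha (by linarith) hab hA hB hMf
  have hE1 : -(1 / 2) + e₁ = E := by
    have : -(s : ℝ) / d = -σ := by rw [hσ, neg_div]
    rw [he₁, this, hexp, hE, this, ← hσ, add_comm, ← sub_eq_add_neg, ← max_sub_sub_right]
    congr 1
    ring
  -- The left side equals the first entry of the maximum, because p < 2q makes the positive part in
  -- e₂ active.
  have hE2 : -(1 / 2) + q * e₂ ≤ E := by
    have h1 : -(s : ℝ) / d = -σ := by rw [hσ, neg_div]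
    have h2 : 1 / (2 * (q : ℝ)) ≤ 1 / p := one_div_le_one_div_of_le hp0 hpq.le
    rw [he₂, h1, max_eq_left (by linarith)]
    refine le_trans (le_of_eq ?_) (le_max_left _ _)
    rw [← hσ]
    field_simp
    ring
  have hreal : (m : ℝ) ^ (-(1 / 2) : ℝ) * (q * 2 ^ q * (|Ca| * (m : ℝ) ^ e₁ * |M| ^ (q - 1) +
      (|Cq| * (m : ℝ) ^ e₂) ^ q)) ≤ D * (2 : ℝ) ^ (-E) * ((m + m : ℕ) : ℝ) ^ E := by
    have r1 : (m : ℝ) ^ (-(1 / 2) : ℝ) * (m : ℝ) ^ e₁ = (m : ℝ) ^ E := by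
      rw [← Real.rpow_add hm0, hE1]
    have r2 : (m : ℝ) ^ (-(1 / 2) : ℝ) * ((m : ℝ) ^ e₂) ^ q ≤ (m : ℝ) ^ E := by
      rw [← Real.rpow_natCast, ← Real.rpow_mul hm0.le, ← Real.rpow_add hm0, mul_comm e₂]
      exact Real.rpow_le_rpow_of_exponent_le hm1 hE2
    have r3 : (2 : ℝ) ^ (-E) * ((m + m : ℕ) : ℝ) ^ E = (m : ℝ) ^ E := by
      have : ((m + m : ℕ) : ℝ) = 2 * m := by push_cast; ring
      rw [this, Real.mul_rpow zero_le_two hm0.le, ← mul_assoc, ← Real.rpow_add two_pos]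
      simp
    rw [mul_assoc D, r3, hD]
    calc _ = q * 2 ^ q * (|Ca| * |M| ^ (q - 1) * ((m : ℝ) ^ (-(1 / 2) : ℝ) * (m : ℝ) ^ e₁) +
          |Cq| ^ q * ((m : ℝ) ^ (-(1 / 2) : ℝ) * ((m : ℝ) ^ e₂) ^ q)) := by
          rw [mul_pow]; ring
      _ ≤ q * 2 ^ q * (|Ca| * |M| ^ (q - 1) * (m : ℝ) ^ E + |Cq| ^ q * (m : ℝ) ^ E) := by
          rw [r1]; gcongr
      _ = _ := by ring
  have hfinal : ∫⁻ x, ‖estimator K q m x (f ∘ x) - moment q f‖ₑ ∂(sampleLaw d (m + m)) ≤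
      ENNReal.ofReal (D * (2 : ℝ) ^ (-E) * ((m + m : ℕ) : ℝ) ^ E) := by
    refine (hle.trans (mul_le_mul_right hmean _)).trans
      (le_trans (le_of_eq ?_) (ENNReal.ofReal_le_ofReal hreal))
    rw [← ENNReal.ofReal_pow (abs_nonneg M), ← ENNReal.ofReal_pow (by positivity),
      ← ENNReal.ofReal_mul (by positivity), ← ENNReal.ofReal_add (by positivity) (by positivity),
      ← ENNReal.ofReal_mul (by positivity), ← ENNReal.ofReal_mul (by positivity)]
  refine ⟨⟨hmeas, hfinal.trans_lt ENNReal.ofReal_lt_top⟩, ?_⟩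
  have hint := integral_norm_eq_lintegral_enorm hmeas
  simp only [Real.norm_eq_abs] at hint
  rw [hint]
  exact ENNReal.toReal_le_of_le_ofReal (by positivity) hfinal

end ControlVariate

/-- Part one: constants independent of `n` in the hypothesis and in the conclusion. Part two: if the
constants of the oracle are uniform over a ball of the Sobolev space, so is the final constant. -/
theorem theorem3p1 (d s q : ℕ) (p : ℝ) (hd : 0 < d) (hp : 2 < p) (hqp : (q : ℝ) < p)
    (hpq : p < 2 * q) (hs : (d : ℝ) * (2 * q - p) / (2 * p * q) < s)
    (K : ControlVariate.Oracle d) (hK : ControlVariate.IsFunctionEstimator d s p K) :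
    (∀ f ∈ ControlVariate.sobolev d s p, ControlVariate.HasOracleRate d s p K {f} →
      ∃ C : ℝ, ControlVariate.ErrorBound d s q p K f C) ∧
    (∀ R : ℝ, ControlVariate.HasOracleRate d s p K (ControlVariate.sobolevBall d s p R) →
      ∃ C : ℝ, ∀ f ∈ ControlVariate.sobolevBall d s p R,
        ControlVariate.ErrorBound d s q p K f C) := by
  refine ⟨fun f hf hrate => ?_, fun R hrate => ?_⟩
  -- A single f is a bounded set, so the uniform bound applies to the class {f}.
  · obtain ⟨R, hR⟩ := ControlVariate.exists_mem_sobolevBall hf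
    obtain ⟨C, hC⟩ := ControlVariate.exists_errorBound_of_subset_sobolevBall hd hp hpq hs hK
      (Set.singleton_subset_iff.2 hR) hrate
    exact ⟨C, hC f rfl⟩
  · exact ControlVariate.exists_errorBound_of_subset_sobolevBall hd hp hpq hs hK subset_rfl hrate
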